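/- Let $\varphi:A\to A$ be an injective endomorphism of an infinite finitely generated group $A$, and let $G=\langle t,A : t^{-1}at=\varphi(a)\ (a\in A)\rangle$ be the ascending HNN extension with base $A\le G$ and stable letter $t$; assume that $G$ is finitely presented. Let $\mathcal P$ be any finite presentation of $G$ with a finite set of generators that contains a set $\mathcal A$ generating $A$, and let $X$ be its Cayley 2-complex: the vertices are the elements of $G$, there is an edge labeled $s$ from $g$ to $gs$ for each $g\in G$ and each generator $s$, and for each $g\in G$ and each relator $w$ a 2-cell is attached along the edge loop at $g$ that reads $w$. Let $\Lambda\subset X$ be the Cayley graph of $A$ with respect to $\mathcal A$. Then for every integer $N\ge 0$ the subgroup $t^NAt^{-N}$ is semistable at $\infty$ in $G$; that is, for every compact set $C\subset X$ there is a compact set $D\subset X$ such that any two proper edge path rays in $t^N\Lambda-D$ based at the same vertex $v\in t^NA$ are properly homotopic rel $\{v\}$ by a proper homotopy with image in $X-C$. Moreover, if $t$ is one of the generators of $\mathcal P$, then for every $N\ge 0$ and every compact set $C\subset X$ there is a compact set $D\subset X$ such that every proper edge path ray in $t^N\Lambda-D$ based at a vertex $v\in t^NA$ is properly homotopic rel $\{v\}$,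 by a proper homotopy with image in $X-C$, to the edge path ray at $v$ all of whose edges are labeled $t$. -/

import Mathlib

open scoped NNReal

noncomputable section

namespace AscHNN

/-! ### Ascending HNN extensions -/

/-- The ascending HNN extension `⟨t, H : t⁻¹ h t = φ h⟩` of a monomorphism `φ : H → H`.
Mathlib's `HNNExtension H K L ψ` has the relations `t k t⁻¹ = ψ k` for `k ∈ K`; here `K = φ(H)`,
`L = H` and `ψ (φ h) = h`. -/
abbrev AscendingHNN {H : Type*} [Group H] (φ : H →* H) (hφ : Function.Injective φ) : Type _ :=
  HNNExtension H φ.range ⊤ ((MonoidHom.ofInjective hφ).symm.trans Subgroup.topEquiv.symm)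

/-- The defining relation `t⁻¹ h t = φ h`. -/
theorem AscendingHNN.conj_eq {H : Type*} [Group H] (φ : H →* H) (hφ : Function.Injective φ)
    (h : H) : ((HNNExtension.t : AscendingHNN φ hφ)⁻¹ * HNNExtension.of h * HNNExtension.t
      : AscendingHNN φ hφ) = HNNExtension.of (φ h) := by
  have key := HNNExtension.t_mul_of (G := H) (A := φ.range) (B := ⊤)
    (φ := (MonoidHom.ofInjective hφ).symm.trans Subgroup.topEquiv.symm)
    (MonoidHom.ofInjective hφ h)
  simp only [MulEquiv.trans_apply, MulEquiv.symm_apply_apply, MonoidHom.ofInjective_apply] at key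
  rw [mul_assoc, inv_mul_eq_iff_eq_mul, key]
  rfl

/-- `G` is an ascending HNN extension with base the subgroup `A` and stable letter `t`. -/
def IsAscendingHNNExtension {G : Type*} [Group G] (A : Subgroup G) (t : G) : Prop :=
  ∃ (φ : A →* A) (hφ : Function.Injective φ) (e : AscendingHNN φ hφ ≃* G),
    (∀ a : A, e (HNNExtension.of a) = a) ∧ e HNNExtension.t = t

/-! ### Finite presentations and their Cayley 2-complexes -/

/-- A finite presentation of `G` on the finite set `S` of generating symbols. A relator is a word
in `S` and formal inverses, where the letter `(s, true)` is `s` and `(s, false)` is `s⁻¹`. -/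
structure FinitePresentation (G : Type*) [Group G] (S : Type*) where
  finite_gens : Finite S
  /-- the element of `G` that a generating symbol stands for -/
  val : S → G
  /-- the relators -/
  rels : Set (List (S × Bool))
  finite_rels : rels.Finite
  surjective : Function.Surjective (FreeGroup.lift val)
  ker_eq : (FreeGroup.lift val).ker = Subgroup.normalClosure (FreeGroup.mk '' rels)

namespace FinitePresentation

variable {G : Type*} [Group G] {S : Type*} (P : FinitePresentation G S)

/-- The value in `G` of a letter `s` or `s⁻¹`. -/
def letter (l : S × Bool) : G := if l.2 then P.val l.1 else (P.val l.1)⁻¹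

/-- The closed cells of the Cayley 2-complex, as a disjoint union: a vertex for each `g ∈ G`,
an edge `[0,1]` for each `g ∈ G` and each generator, and a closed unit disc for each `g ∈ G`
and each relator. -/
abbrev Cells : Type _ :=
  (Σ _ : G, PUnit.{1}) ⊕ (Σ _ : G × S, unitInterval) ⊕
    (Σ _ : G × P.rels, Metric.closedBall (0 : ℂ) 1)

/-- The vertex `g`. -/
def vertexCell (g : G) : P.Cells := Sum.inl ⟨g, PUnit.unit⟩

/-- The point with parameter `x` of the edge labeled `s` that leads from `g` to `g * s`. -/
def edgeCell (g : G) (s : S) (x : unitInterval) : P.Cells := Sum.inr (Sum.inl ⟨(g, s), x⟩)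

/-- The point `z` of the disc at `g` for the relator `r`. -/
def faceCell (g : G) (r : P.rels) (z : Metric.closedBall (0 : ℂ) 1) : P.Cells :=
  Sum.inr (Sum.inr ⟨(g, r), z⟩)

/-- The point with parameter `x` of the oriented edge that starts at `g` and reads the letter `l`:
for `l = s` the edge labeled `s` at `g`, for `l = s⁻¹` the edge labeled `s` at `g * s⁻¹`,
traversed backwards. -/
def stepCell (g : G) (l : S × Bool) (x : unitInterval) : P.Cells :=
  if l.2 then P.edgeCell g l.1 x else P.edgeCell (g * (P.val l.1)⁻¹) l.1 (unitInterval.symm x)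

/-- The point with parameter `y ∈ [0, length w]` of the edge path that starts at `g` and reads
the word `w`, each edge taking unit time. -/
def wordCell : G → List (S × Bool) → ℝ → P.Cells
  | g, [], _ => P.vertexCell g
  | g, l :: w, y =>
      if y ≤ 1 then P.stepCell g l (Set.projIcc 0 1 zero_le_one y)
      else wordCell (g * P.letter l) w (y - 1)

/-- The gluing: both ends of an edge are glued to its end vertices, and the boundary circle of the
disc at `g` for the relator `r` is glued along the edge loop at `g` that reads `r`. -/
inductive Glue : P.Cells → P.Cells → Prop
  | source (g : G) (s : S) : Glue (P.edgeCell g s 0) (P.vertexCell g)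
  | target (g : G) (s : S) : Glue (P.edgeCell g s 1) (P.vertexCell (g * P.val s))
  | boundary (g : G) (r : P.rels) (z : Metric.closedBall (0 : ℂ) 1) (x : unitInterval)
      (hz : (z : ℂ) = Complex.exp (2 * Real.pi * (x : ℝ) * Complex.I)) :
      Glue (P.faceCell g r z) (P.wordCell g r.1 ((x : ℝ) * r.1.length))

/-- The Cayley 2-complex of a finite presentation, with the quotient topology. -/
def CayleyComplex : Type _ := Quot P.Glue

instance : TopologicalSpace P.CayleyComplex := inferInstanceAs (TopologicalSpace (Quot P.Glue))

/-- The vertices of the edge path ray that starts at `v` and reads the letters `l 0, l 1, …`. -/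
def rayVertex (v : G) (l : ℕ → S × Bool) : ℕ → G
  | 0 => v
  | n + 1 => rayVertex v l n * P.letter (l n)

/-- The edge path ray `[0,∞) → X` in the Cayley 2-complex `X` that starts at the vertex `v` and
reads the letters `l 0, l 1, …`; the edge number `n` is traversed on `[n, n+1]`. -/
def ray (v : G) (l : ℕ → S × Bool) (y : ℝ≥0) : P.CayleyComplex :=
  Quot.mk P.Glue (P.stepCell (P.rayVertex v l ⌊y⌋₊) (l ⌊y⌋₊)
    (Set.projIcc 0 1 zero_le_one ((y : ℝ) - ⌊y⌋₊)))

end FinitePresentation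

/-! ### Semistability at infinity of a subgroup -/

/-- The rays `r` and `s` (with the same initial point) in `X` are properly homotopic relative to
this point, by a proper homotopy in `X - C`. -/
def ProperlyHomotopicRelAvoiding {X : Type*} [TopologicalSpace X] (C : Set X)
    (r s : ℝ≥0 → X) : Prop :=
  ∃ H : ℝ≥0 × unitInterval → X, IsProperMap H ∧ (∀ x, H (x, 0) = r x) ∧ (∀ x, H (x, 1) = s x) ∧
    (∀ y, H (0, y) = r 0) ∧ ∀ p, H p ∉ C

namespace FinitePresentation

variable {G : Type*} [Group G] {S : Type*} (P : FinitePresentation G S)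

/-- The letters `l` read a proper edge path ray at `v` which lies in `g Λ - D`, where `Λ` is the
Cayley graph of the subgroup `A` with respect to the set `𝒜` of generators (so `v ∈ g A` and all
edges are labeled by elements of `𝒜`). -/
structure IsProperRayIn (A : Subgroup G) (𝒜 : Set S) (g : G) (D : Set P.CayleyComplex)
    (v : G) (l : ℕ → S × Bool) : Prop where
  base : ∃ a ∈ A, v = g * a
  labels : ∀ n, (l n).1 ∈ 𝒜
  proper : IsProperMap (P.ray v l)
  avoids : ∀ y, P.ray v l y ∉ D

/-- `g A g⁻¹` is semistable at infinity in the Cayley 2-complex with respect to `C`. -/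
def SemistableAtInfinityWrt (A : Subgroup G) (𝒜 : Set S) (g : G) (C : Set P.CayleyComplex) :
    Prop :=
  ∃ D : Set P.CayleyComplex, IsCompact D ∧ ∀ (v : G) (l m : ℕ → S × Bool),
    P.IsProperRayIn A 𝒜 g D v l → P.IsProperRayIn A 𝒜 g D v m →
      ProperlyHomotopicRelAvoiding C (P.ray v l) (P.ray v m)

/-- `g A g⁻¹` is semistable at infinity in the Cayley 2-complex. -/
def SemistableAtInfinity (A : Subgroup G) (𝒜 : Set S) (g : G) : Prop :=
  ∀ C : Set P.CayleyComplex, IsCompact C → P.SemistableAtInfinityWrt A 𝒜 g C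

end FinitePresentation

end AscHNN

end

noncomputable section

namespace AscHNN

/-! ### Generic topology -/

section Topology

open Filter Topology Set

/-! Every proper ray in `t ^ N Λ` that avoids a suitable compact set is pushed off to infinity in
the direction of `t`. Let `V i` be its vertices and `l i` its letters. Since `a * t = t * φ a`, the
edge `l i` spans an infinite strip of squares: the `j`-th is based at `V i * t ^ j`, its bottom and
top are words for `φ^j` and `φ^(j+1)` of the letter, and its sides read a word `T` for `t`.
Neighbouring strips share their sides, so they form a map of a quadrant whose bottom is the given
ray and whose left side reads `T T T …`. Sweeping the quadrant by the segments from `(x, 0)` to `(0,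
x)` is the required homotopy; two rays at `v` are compared through the common ray `T T T …`.

Control at infinity comes from the homomorphism `lev : G → ℤ` that kills `A` and sends `t` to `1`.
The squares are filled letter by letter from finitely many fillings translated by elements of level
`0`, so the filling of a square based at level `N + j` stays above level `N + j - R`, with `R`
independent of `j` (`exists_fill_pushed`). Hence a given vertex `h` is met only at bounded heights
`j`, and, each filling being finite, only over finitely many base vertices `V i`. Removing these
base vertices for the finitely many `h` near `C` keeps the homotopy off `C`; the same finiteness,
with properness of the ray, makes the homotopy proper (`exists_compact_tameHomotopic`).

The fillings exist because words with equal value differ by free reductions and relators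
(`Equivalent.of_wordVal_eq`). Their supports are measured by continuous barycentric coordinates
`bary h`, whose nonvanishing sets form an open cover of the complex. -/

/-- A continuous map to a Hausdorff space is proper as soon as every point of the target has a
neighbourhood whose preimage is contained in a compact set. -/
theorem isProperMap_of_nhds_preimage_subset_compact {Y X : Type*} [TopologicalSpace Y]
    [TopologicalSpace X] [T2Space X] {f : Y → X} (hf : Continuous f)
    (h : ∀ x, ∃ V ∈ 𝓝 x, ∃ K, IsCompact K ∧ f ⁻¹' V ⊆ K) : IsProperMap f := by
  rw [isProperMap_iff_ultrafilter]
  refine ⟨hf, fun 𝒰 x hx => ?_⟩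
  obtain ⟨V, hV, K, hK, hVK⟩ := h x
  obtain ⟨y, -, hy⟩ := hK.ultrafilter_le_nhds 𝒰
    (le_principal_iff.2 (mem_of_superset (hx hV) hVK))
  exact ⟨y, tendsto_nhds_unique ((hf.tendsto y).mono_left hy) hx, hy⟩

/-! ### Cones over functions on the circle -/

/-- The cone on a function on the unit circle, the latter being parametrized by `[0,1]`. -/
def radial {E : Type*} [NormedAddCommGroup E] [NormedSpace ℝ E] (b : ℝ → E) (z : ℂ) : E :=
  haveI : Fact (0 < 2 * Real.pi) := ⟨Real.two_pi_pos⟩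
  ‖z‖ • AddCircle.liftIco (2 * Real.pi) 0 (fun θ => b (θ / (2 * Real.pi))) (z.arg : Real.Angle)

/-- Away from the origin the argument is continuous as an angle, and `b 0 = b 1` makes `b` a
continuous function on the circle. At the origin the factor `‖z‖` wins, since that function is
bounded by compactness of the circle. -/
theorem continuous_radial {E : Type*} [NormedAddCommGroup E] [NormedSpace ℝ E] {b : ℝ → E}
    (hb : Continuous b) (h01 : b 0 = b 1) : Continuous (radial b) := by
  have : Fact (0 < 2 * Real.pi) := ⟨Real.two_pi_pos⟩
  have hc : Continuous (AddCircle.liftIco (2 * Real.pi) 0 (fun θ => b (θ / (2 * Real.pi)))) := by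
    apply AddCircle.liftIco_zero_continuous
    · simp [h01, Real.pi_ne_zero]
    · exact (hb.comp (continuous_id.div_const _)).continuousOn
  rw [continuous_iff_continuousAt]
  intro z
  by_cases hz : z = 0
  · subst hz
    obtain ⟨M, hM⟩ := (isCompact_range hc).isBounded.exists_norm_le
    have h0 : radial b 0 = 0 := by simp [radial]
    rw [ContinuousAt, h0]
    refine squeeze_zero_norm (a := fun z : ℂ => ‖z‖ * M) (fun z => ?_) ?_
    · rw [radial, norm_smul, norm_norm]
      exact mul_le_mul_of_nonneg_left (hM _ (mem_range_self _)) (norm_nonneg _)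
    · have : Continuous (fun z : ℂ => ‖z‖ * M) := by fun_prop
      simpa using this.tendsto 0
  · exact continuous_norm.continuousAt.smul
      (hc.continuousAt.comp (Complex.continuousAt_arg_coe_angle hz))

theorem radial_exp {E : Type*} [NormedAddCommGroup E] [NormedSpace ℝ E] {b : ℝ → E}
    (h01 : b 0 = b 1) {x : ℝ} (hx : x ∈ Icc (0 : ℝ) 1) :
    radial b (Complex.exp (2 * Real.pi * x * Complex.I)) = b x := by
  have : Fact (0 < 2 * Real.pi) := ⟨Real.two_pi_pos⟩
  have e : (2 * Real.pi * x * Complex.I : ℂ) = ((2 * Real.pi * x : ℝ) : ℂ) * Complex.I := by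
    push_cast; ring
  have harg : ((Complex.exp (2 * Real.pi * x * Complex.I)).arg : Real.Angle)
      = ((2 * Real.pi * x : ℝ) : Real.Angle) := by
    rw [e, Complex.arg_exp_mul_I, Real.Angle.coe_toIocMod]
  rw [radial, harg, e, Complex.norm_exp_ofReal_mul_I, one_smul]
  have hp := Real.pi_pos
  rcases hx.2.eq_or_lt with rfl | h1
  · rw [mul_one, Real.Angle.coe_two_pi, ← Real.Angle.coe_zero]
    refine (AddCircle.liftIco_zero_coe_apply ⟨le_rfl, Real.two_pi_pos⟩).trans ?_
    simp [h01]
  · refine (AddCircle.liftIco_zero_coe_apply ⟨by have := hx.1; positivity, ?_⟩).trans ?_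
    · nlinarith
    · congr 1; field_simp

theorem exists_ne_zero_of_radial_ne_zero {b : ℝ → ℝ} {z : ℂ} (h : radial b z ≠ 0) :
    ∃ x ∈ Icc (0 : ℝ) 1, b x ≠ 0 := by
  have : Fact (0 < 2 * Real.pi) := ⟨Real.two_pi_pos⟩
  have h2 := right_ne_zero_of_smul h
  obtain ⟨θ, hθ, he⟩ := AddCircle.eq_coe_Ico (p := 2 * Real.pi) (z.arg : Real.Angle)
  rw [← he, AddCircle.liftIco_zero_coe_apply hθ] at h2
  exact ⟨_, ⟨div_nonneg hθ.1 Real.two_pi_pos.le, (div_le_one Real.two_pi_pos).2 hθ.2.le⟩, h2⟩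

/-! ### Homotopies of Moore paths -/

/-- The Moore paths `γ : [0,m] → X` and `δ : [0,n] → X` from `p` to `q` (which are constant outside
of these intervals) are homotopic in `Y` relative to their endpoints. -/
def MooreHomotopic {X : Type*} [TopologicalSpace X] (Y : Set X) (p q : X) (γ : ℝ → X) (m : ℝ)
    (δ : ℝ → X) (n : ℝ) : Prop :=
  ∃ (H : ℝ × ℝ → X) (d : ℝ → ℝ), Continuous H ∧ Continuous d ∧ (∀ s, 0 ≤ d s) ∧ d 0 = m ∧ d 1 = n ∧
    (∀ y, H (y, 0) = γ y) ∧ (∀ y, H (y, 1) = δ y) ∧ (∀ s, ∀ y ≤ 0, H (y, s) = p) ∧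
    (∀ s y, d s ≤ y → H (y, s) = q) ∧ ∀ z, H z ∈ Y

namespace MooreHomotopic

variable {X : Type*} [TopologicalSpace X] {Y : Set X} {p q r : X} {γ δ ε γ' δ' : ℝ → X}
  {m n k m' n' : ℝ}

theorem mono {Z : Set X} (h : MooreHomotopic Y p q γ m δ n) (hYZ : Y ⊆ Z) :
    MooreHomotopic Z p q γ m δ n := by
  obtain ⟨H, d, h1, h2, h3, h4, h5, h6, h7, h8, h9, h10⟩ := h
  exact ⟨H, d, h1, h2, h3, h4, h5, h6, h7, h8, h9, fun z => hYZ (h10 z)⟩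

theorem refl (hγ : Continuous γ) (hm : 0 ≤ m) (h0 : ∀ y ≤ 0, γ y = p) (h1 : ∀ y, m ≤ y → γ y = q)
    (hY : ∀ y, γ y ∈ Y) : MooreHomotopic Y p q γ m γ m :=
  ⟨fun z => γ z.1, fun _ => m, by fun_prop, by fun_prop, fun _ => hm, rfl, rfl, fun _ => rfl,
    fun _ => rfl, fun _ => h0, fun _ => h1, fun _ => hY _⟩

theorem symm (h : MooreHomotopic Y p q γ m δ n) : MooreHomotopic Y p q δ n γ m := by
  obtain ⟨H, d, h1, h2, h3, h4, h5, h6, h7, h8, h9, h10⟩ := h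
  exact ⟨fun z => H (z.1, 1 - z.2), fun s => d (1 - s), by fun_prop, by fun_prop, fun s => h3 _,
    by simpa, by simpa, by simpa, by simpa, fun s y hy => h8 _ y hy, fun s y hy => h9 _ y hy,
    fun z => h10 _⟩

theorem trans (h : MooreHomotopic Y p q γ m δ n) (h' : MooreHomotopic Y p q δ n ε k) :
    MooreHomotopic Y p q γ m ε k := by
  obtain ⟨H, d, h1, h2, h3, h4, h5, h6, h7, h8, h9, h10⟩ := h
  obtain ⟨H', d', g1, g2, g3, g4, g5, g6, g7, g8, g9, g10⟩ := h'
  refine ⟨fun z => if z.2 ≤ 1 / 2 then H (z.1, 2 * z.2) else H' (z.1, 2 * z.2 - 1),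
    fun s => if s ≤ 1 / 2 then d (2 * s) else d' (2 * s - 1), ?_, ?_, ?_, ?_, ?_, ?_, ?_, ?_, ?_, ?_⟩
  · refine Continuous.if_le (by fun_prop) (by fun_prop) (by fun_prop) (by fun_prop) ?_
    rintro ⟨y, s⟩ (hs : s = 1 / 2)
    subst hs
    norm_num [h7, g6]
  · refine Continuous.if_le (by fun_prop) (by fun_prop) (by fun_prop) (by fun_prop) ?_
    rintro s (hs : s = 1 / 2)
    subst hs
    norm_num [h5, g4]
  · intro s; dsimp only; split_ifs
    exacts [h3 _, g3 _]
  · norm_num [h4]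
  · norm_num [g5]
  · norm_num [h6]
  · norm_num [g7]
  · intro s y hy; dsimp only; split_ifs
    exacts [h8 _ _ hy, g8 _ _ hy]
  · intro s y hy; dsimp only at hy ⊢; split_ifs at hy ⊢
    exacts [h9 _ _ hy, g9 _ _ hy]
  · intro z; dsimp only; split_ifs
    exacts [h10 _, g10 _]

/-- Homotopies of Moore paths can be concatenated. -/
theorem concat (h : MooreHomotopic Y p q γ m δ n) (h' : MooreHomotopic Y q r γ' m' δ' n') :
    MooreHomotopic Y p r (fun y => if y ≤ m then γ y else γ' (y - m)) (m + m')
      (fun y => if y ≤ n then δ y else δ' (y - n)) (n + n') := by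
  obtain ⟨H, d, h1, h2, h3, h4, h5, h6, h7, h8, h9, h10⟩ := h
  obtain ⟨H', d', g1, g2, g3, g4, g5, g6, g7, g8, g9, g10⟩ := h'
  refine ⟨fun z => if z.1 ≤ d z.2 then H z else H' (z.1 - d z.2, z.2), fun s => d s + d' s,
    ?_, by fun_prop, fun s => add_nonneg (h3 s) (g3 s), by simp [h4, g4], by simp [h5, g5], ?_, ?_,
    ?_, ?_, ?_⟩
  · refine Continuous.if_le (by fun_prop) (by fun_prop) (by fun_prop) (by fun_prop) ?_
    rintro ⟨y, s⟩ (hs : y = d s)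
    simp only
    rw [h9 _ _ hs.ge, g8 _ _ (by simp [hs])]
  · intro y; simp [h4, h6, g6]
  · intro y; simp [h5, h7, g7]
  · intro s y hy
    simp [hy.trans (h3 s), h8 s y hy]
  · intro s y hy
    dsimp only
    split_ifs with hle
    -- Here the second path has length zero at stage `s`, so its endpoints `q` and `r` coincide.
    · have h0 : d' s ≤ 0 := by linarith
      rw [h9 s y (by linarith [g3 s]), ← g8 s 0 le_rfl, g9 s 0 h0]
    · exact g9 _ _ (by linarith)
  · intro z; dsimp only; split_ifs
    exacts [h10 _, g10 _]

end MooreHomotopic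

/-- The parameter `s` may be discontinuous at `z`: `h` is constant on the line over `c`, and
compactness of `[0,1]` gives a tube around its unit segment that maps into a given neighbourhood of
`p`. This handles two corners of a square where the homotopy parameter has no limit. -/
theorem continuousAt_of_constant_side {Z X : Type*} [TopologicalSpace Z] [TopologicalSpace X]
    {h : ℝ × ℝ → X} (hh : Continuous h) {c : ℝ} {p : X} (hp : ∀ s, h (c, s) = p) {a s : Z → ℝ}
    {z : Z} (ha : ContinuousAt a z) (haz : a z = c) (hs : ∀ w, s w ∈ Icc (0 : ℝ) 1) :
    ContinuousAt (fun w => h (a w, s w)) z := by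
  have hz : h (a z, s z) = p := by rw [haz, hp]
  rw [ContinuousAt, hz, tendsto_nhds]
  intro W hW hpW
  obtain ⟨U, V, hU, -, hcU, hIV, hUV⟩ := generalized_tube_lemma (s := {c}) isCompact_singleton
    (t := Icc (0 : ℝ) 1) isCompact_Icc (n := h ⁻¹' W) (hW.preimage hh) (by
      rintro ⟨x, y⟩ ⟨hx, -⟩
      obtain rfl : x = c := hx
      simpa [hp] using hpW)
  filter_upwards [ha (hU.mem_nhds (by simpa [haz] using hcU))] with w hw
  exact hUV (mk_mem_prod hw (hIV (hs w)))

/-- A homotopy between two Moore paths that are each divided into two pieces can be rewritten as a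
map of the unit square, with the pieces on the sides. -/
theorem MooreHomotopic.exists_square {X : Type*} [TopologicalSpace X] {Y : Set X} {p q : X}
    {γ δ : ℝ → X} {a k b : ℝ} (ha : 0 ≤ a) (hb : 0 ≤ b) (hk : 0 < k)
    (h : MooreHomotopic Y p q γ (a + k) δ (k + b)) :
    ∃ Q : ℝ × ℝ → X, ContinuousOn Q (Icc 0 1 ×ˢ Icc 0 1) ∧
      (∀ x ∈ Icc (0 : ℝ) 1, Q (x, 0) = γ (x * a)) ∧
      (∀ y ∈ Icc (0 : ℝ) 1, Q (1, y) = γ (a + y * k)) ∧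
      (∀ y ∈ Icc (0 : ℝ) 1, Q (0, y) = δ (y * k)) ∧
      (∀ x ∈ Icc (0 : ℝ) 1, Q (x, 1) = δ (k + x * b)) ∧ ∀ z, Q z ∈ Y := by
  obtain ⟨H, d, h1, h2, h3, h4, h5, h6, h7, h8, h9, h10⟩ := h
  have hak : 0 < a + k := by linarith
  have hkb : 0 < k + b := by linarith
  let h : ℝ × ℝ → X := fun z => H (z.1 * d z.2, z.2)
  have hh : Continuous h := by fun_prop
  have hp : ∀ s, h (0, s) = p := fun s => by simp [h, h8]
  have hq : ∀ s, h (1, s) = q := fun s => by simp [h, h9]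
  -- `A` vanishes on the bottom and right sides, `B` on the left and top. So, away from the corners
  -- `(0,0)` and `(1,1)`, the homotopy parameter `s` is `0` on the sides that carry `γ` and `1` on
  -- those that carry `δ`. The functions `α` and `β` are the normalized times along `γ` and `δ`, and
  -- `τ` interpolates between them.
  let A : ℝ × ℝ → ℝ := fun z => z.2 * (1 - z.1)
  let B : ℝ × ℝ → ℝ := fun z => z.1 * (1 - z.2)
  let s : ℝ × ℝ → ℝ := fun z => A z / (A z + B z)
  let α : ℝ × ℝ → ℝ := fun z => (z.1 * a + z.2 * k) / (a + k)
  let β : ℝ × ℝ → ℝ := fun z => (z.2 * k + z.1 * b) / (k + b)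
  let τ : ℝ × ℝ → ℝ := fun z => α z + s z * (β z - α z)
  have hA : Continuous A := by fun_prop
  have hB : Continuous B := by fun_prop
  have hα : Continuous α := by fun_prop
  have hβ : Continuous β := by fun_prop
  have hsI : ∀ z ∈ Icc (0 : ℝ) 1 ×ˢ Icc (0 : ℝ) 1, s z ∈ Icc (0 : ℝ) 1 := by
    rintro ⟨x, y⟩ ⟨⟨hx0, hx1⟩, hy0, hy1⟩
    have hA0 : 0 ≤ A (x, y) := mul_nonneg hy0 (sub_nonneg.2 hx1)
    have hB0 : 0 ≤ B (x, y) := mul_nonneg hx0 (sub_nonneg.2 hy1)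
    exact ⟨by positivity, div_le_one_of_le₀ (by linarith) (by linarith)⟩
  -- At the two bad corners `α = β`, so the jump of `s` is multiplied by a factor that tends to
  -- zero.
  have hcorner : ∀ w ∈ Icc (0 : ℝ) 1 ×ˢ Icc (0 : ℝ) 1, α w = β w →
      ContinuousWithinAt τ (Icc 0 1 ×ˢ Icc 0 1) w := by
    intro w hw he
    refine ContinuousWithinAt.add hα.continuousWithinAt ?_
    rw [ContinuousWithinAt, he, sub_self, mul_zero]
    have h0 : Tendsto (fun z => |β z - α z|) (𝓝[Icc 0 1 ×ˢ Icc 0 1] w) (𝓝 0) := by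
      have : Continuous (fun z => |β z - α z|) := by fun_prop
      simpa [he] using (this.tendsto w).mono_left nhdsWithin_le_nhds
    refine squeeze_zero_norm' ?_ h0
    filter_upwards [self_mem_nhdsWithin] with z hz
    rw [Real.norm_eq_abs, abs_mul, abs_of_nonneg (hsI z hz).1]
    exact mul_le_of_le_one_left (abs_nonneg _) (hsI z hz).2
  refine ⟨fun z => h (τ z, s z), ?_, ?_, ?_, ?_, ?_, fun z => h10 _⟩
  · rw [continuousOn_iff_continuous_domRestrict, continuous_iff_continuousAt]
    rintro ⟨⟨x, y⟩, hxy⟩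
    have hsI' : ∀ w : ↥(Icc (0 : ℝ) 1 ×ˢ Icc (0 : ℝ) 1), s w ∈ Icc (0 : ℝ) 1 := fun w => hsI w w.2
    by_cases h00 : x = 0 ∧ y = 0
    · obtain ⟨rfl, rfl⟩ := h00
      exact continuousAt_of_constant_side hh hp (a := fun w : ↥(Icc (0 : ℝ) 1 ×ˢ Icc (0 : ℝ) 1) => τ w)
        (s := fun w => s w)
        ((continuousWithinAt_iff_continuousAt_domRestrict τ hxy).1 (hcorner _ hxy (by simp [α, β])))
        (by simp [τ, α, β]) hsI'
    by_cases h11 : x = 1 ∧ y = 1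
    · obtain ⟨rfl, rfl⟩ := h11
      have e1 : α (1, 1) = 1 := by simp [α, hak.ne']
      have e2 : β (1, 1) = 1 := by simp [β, hkb.ne']
      exact continuousAt_of_constant_side hh hq (a := fun w : ↥(Icc (0 : ℝ) 1 ×ˢ Icc (0 : ℝ) 1) => τ w)
        (s := fun w => s w)
        ((continuousWithinAt_iff_continuousAt_domRestrict τ hxy).1 (hcorner _ hxy (by rw [e1, e2])))
        (by simp [τ, e1, e2]) hsI'
    have hne : A (x, y) + B (x, y) ≠ 0 := by
      obtain ⟨⟨hx0, hx1⟩, hy0, hy1⟩ := hxy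
      dsimp only at hx0 hx1 hy0 hy1
      intro h0
      have hA0 : 0 ≤ A (x, y) := mul_nonneg hy0 (sub_nonneg.2 hx1)
      have hB0 : 0 ≤ B (x, y) := mul_nonneg hx0 (sub_nonneg.2 hy1)
      have hA1 : y * (1 - x) = 0 := by change A (x, y) = 0; linarith
      have hB1 : x * (1 - y) = 0 := by change B (x, y) = 0; linarith
      have hxy : x = y := by linarith
      subst hxy
      rcases mul_eq_zero.1 hA1 with h | h
      · exact h00 ⟨h, h⟩
      · exact h11 ⟨by linarith, by linarith⟩
    have hs : ContinuousAt s (x, y) := hA.continuousAt.div (hA.add hB).continuousAt hne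
    have hτ : ContinuousAt τ (x, y) :=
      hα.continuousAt.add (hs.mul (hβ.sub hα).continuousAt)
    have : ContinuousAt (fun z => h (τ z, s z)) (x, y) :=
      hh.continuousAt.comp (f := fun z => (τ z, s z)) (hτ.prodMk hs)
    exact ContinuousAt.comp (g := fun z => h (τ z, s z))
      (f := fun w : ↥(Icc (0 : ℝ) 1 ×ˢ Icc (0 : ℝ) 1) => (w : ℝ × ℝ)) this
      continuous_subtype_val.continuousAt
  · rintro x -
    have hs : s (x, 0) = 0 := by simp [s, A]
    simp only [τ, hs, h, zero_mul, add_zero, h4, h6]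
    congr 1; simp [α]; field_simp
  · rintro y -
    have hs : s (1, y) = 0 := by simp [s, A]
    simp only [τ, hs, h, zero_mul, add_zero, h4, h6]
    congr 1; simp [α]; field_simp
  · rintro y -
    by_cases hy : y = 0
    · subst hy
      have e : τ (0, 0) = 0 := by simp [τ, α, β]
      simp only [e]
      rw [hp, ← h7, h8 _ _ (by simp)]
    · have hs : s (0, y) = 1 := by simp [s, A, B, hy]
      simp only [τ, hs, h, one_mul, h5, add_sub_cancel, h7]
      congr 1; simp [β]; field_simp
  · rintro x -
    by_cases hx : x = 1
    · subst hx
      have e1 : α (1, 1) = 1 := by simp [α, hak.ne']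
      have e2 : β (1, 1) = 1 := by simp [β, hkb.ne']
      have e : τ (1, 1) = 1 := by simp [τ, e1, e2]
      simp only [e]
      rw [hq, ← h7, h9 _ _ (by simp [h5])]
    · have hs : s (x, 1) = 1 := by
        have : 1 - x ≠ 0 := fun h => hx (by linarith)
        simp [s, A, B, this]
      simp only [τ, hs, h, one_mul, h5, add_sub_cancel, h7]
      congr 1; simp [β]; field_simp

/-! ### Gluing unit squares to a quadrant -/

/-- The map on the quadrant that is given by `Q i j` on the unit square with lower left corner
`(i, j)`. -/
def quadrantMap {X : Type*} (Q : ℕ → ℕ → ℝ × ℝ → X) (z : ℝ≥0 × ℝ≥0) : X :=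
  Q ⌊z.1⌋₊ ⌊z.2⌋₊ ((z.1 : ℝ) - ⌊z.1⌋₊, (z.2 : ℝ) - ⌊z.2⌋₊)

theorem floor_cases {x : ℝ≥0} {i : ℕ} (h : x ∈ Icc (i : ℝ≥0) (i + 1)) :
    ⌊x⌋₊ = i ∨ x = i + 1 ∧ ⌊x⌋₊ = i + 1 := by
  rcases h.2.eq_or_lt with h1 | h1
  · right
    exact ⟨h1, by rw [h1]; exact_mod_cast Nat.floor_natCast (R := ℝ≥0) (i + 1)⟩
  · left
    exact (Nat.floor_eq_iff zero_le).2 ⟨h.1, h1⟩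

theorem sub_mem_unit {x : ℝ≥0} {i : ℕ} (h : x ∈ Icc (i : ℝ≥0) (i + 1)) :
    (x : ℝ) - i ∈ Icc (0 : ℝ) 1 := by
  have h1 : (i : ℝ) ≤ x := by exact_mod_cast h.1
  have h2 : (x : ℝ) ≤ i + 1 := by exact_mod_cast h.2
  constructor <;> linarith

theorem mem_floor_interval (x : ℝ≥0) : x ∈ Icc (⌊x⌋₊ : ℝ≥0) (⌊x⌋₊ + 1) :=
  ⟨Nat.floor_le zero_le, (Nat.lt_floor_add_one x).le⟩

/-- On the right and upper sides of a closed square the floor has already jumped to the neighbour;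
the matching conditions make this harmless. The formula is needed on closed squares because
continuity is glued over a locally finite closed cover. -/
theorem quadrantMap_eq {X : Type*} {Q : ℕ → ℕ → ℝ × ℝ → X}
    (hh : ∀ i j, ∀ y ∈ Icc (0 : ℝ) 1, Q i j (1, y) = Q (i + 1) j (0, y))
    (hv : ∀ i j, ∀ x ∈ Icc (0 : ℝ) 1, Q i j (x, 1) = Q i (j + 1) (x, 0)) {i j : ℕ}
    {z : ℝ≥0 × ℝ≥0} (h1 : z.1 ∈ Icc (i : ℝ≥0) (i + 1)) (h2 : z.2 ∈ Icc (j : ℝ≥0) (j + 1)) :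
    quadrantMap Q z = Q i j ((z.1 : ℝ) - i, (z.2 : ℝ) - j) := by
  obtain ⟨x, y⟩ := z
  dsimp only at h1 h2
  have hx := sub_mem_unit h1
  have hy := sub_mem_unit h2
  rcases floor_cases h1 with e1 | ⟨e1, e1'⟩ <;> rcases floor_cases h2 with e2 | ⟨e2, e2'⟩
  · simp only [quadrantMap, e1, e2]
  · simp only [quadrantMap, e1, e2']
    subst e2
    have := hv i j _ hx
    simp only [NNReal.coe_add, NNReal.coe_natCast, NNReal.coe_one, add_sub_cancel_left,
      Nat.cast_add, Nat.cast_one, sub_self] at this ⊢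
    exact this.symm
  · simp only [quadrantMap, e1', e2]
    subst e1
    have := hh i j _ hy
    simp only [NNReal.coe_add, NNReal.coe_natCast, NNReal.coe_one, add_sub_cancel_left,
      Nat.cast_add, Nat.cast_one, sub_self] at this ⊢
    exact this.symm
  · simp only [quadrantMap, e1', e2']
    subst e1 e2
    have := hh i j 1 (by simp)
    have h' := hv (i + 1) j 0 (by simp)
    simp only [NNReal.coe_add, NNReal.coe_natCast, NNReal.coe_one, add_sub_cancel_left,
      Nat.cast_add, Nat.cast_one, sub_self] at this h' ⊢
    rw [this, h']

theorem continuous_quadrantMap {X : Type*} [TopologicalSpace X] {Q : ℕ → ℕ → ℝ × ℝ → X}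
    (hQ : ∀ i j, ContinuousOn (Q i j) (Icc 0 1 ×ˢ Icc 0 1))
    (hh : ∀ i j, ∀ y ∈ Icc (0 : ℝ) 1, Q i j (1, y) = Q (i + 1) j (0, y))
    (hv : ∀ i j, ∀ x ∈ Icc (0 : ℝ) 1, Q i j (x, 1) = Q i (j + 1) (x, 0)) :
    Continuous (quadrantMap Q) := by
  let K : ℕ × ℕ → Set (ℝ≥0 × ℝ≥0) := fun c =>
    Icc (c.1 : ℝ≥0) (c.1 + 1) ×ˢ Icc (c.2 : ℝ≥0) (c.2 + 1)
  refine LocallyFinite.continuous (f := K) ?_ ?_ (fun c => isClosed_Icc.prod isClosed_Icc) ?_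
  · rintro ⟨a, b⟩
    refine ⟨Iio (a + 1) ×ˢ Iio (b + 1), prod_mem_nhds (Iio_mem_nhds (by simp))
      (Iio_mem_nhds (by simp)), ?_⟩
    refine ((finite_Iio (⌊a + 1⌋₊ + 1)).prod (finite_Iio (⌊b + 1⌋₊ + 1))).subset ?_
    rintro ⟨i, j⟩ ⟨⟨x, y⟩, ⟨⟨hx, -⟩, hy, -⟩, hx', hy'⟩
    exact ⟨Nat.lt_succ_of_le (Nat.le_floor (hx.trans (le_of_lt hx'))),
      Nat.lt_succ_of_le (Nat.le_floor (hy.trans (le_of_lt hy')))⟩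
  · refine eq_univ_of_forall fun z => mem_iUnion.2 ⟨(⌊z.1⌋₊, ⌊z.2⌋₊), ?_⟩
    exact ⟨mem_floor_interval _, mem_floor_interval _⟩
  · rintro ⟨i, j⟩
    have : ContinuousOn (fun z : ℝ≥0 × ℝ≥0 => Q i j ((z.1 : ℝ) - i, (z.2 : ℝ) - j)) (K (i, j)) :=
      (hQ i j).comp (by fun_prop) fun z hz => ⟨sub_mem_unit hz.1, sub_mem_unit hz.2⟩
    exact this.congr fun z hz => quadrantMap_eq hh hv hz.1 hz.2

end Topology

/-! ### Words and functions on the Cayley 2-complex -/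

namespace FinitePresentation

open Set Topology

variable {G : Type*} [Group G] {S : Type*} (P : FinitePresentation G S)

/-- The value in `G` of a word. -/
def wordVal (w : List (S × Bool)) : G := (w.map P.letter).prod

@[simp] theorem wordVal_nil : P.wordVal [] = 1 := rfl

@[simp] theorem wordVal_cons (l : S × Bool) (w : List (S × Bool)) :
    P.wordVal (l :: w) = P.letter l * P.wordVal w := by simp [wordVal]

@[simp] theorem wordVal_append (u w : List (S × Bool)) :
    P.wordVal (u ++ w) = P.wordVal u * P.wordVal w := by simp [wordVal]

theorem wordVal_eq_lift (w : List (S × Bool)) :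
    P.wordVal w = FreeGroup.lift P.val (FreeGroup.mk w) := by
  rw [FreeGroup.lift_mk, wordVal]
  congr 1
  refine List.map_congr_left fun l _ => ?_
  cases h : l.2 <;> simp [letter, h]

theorem wordVal_relator {r : List (S × Bool)} (hr : r ∈ P.rels) : P.wordVal r = 1 := by
  rw [wordVal_eq_lift, ← MonoidHom.mem_ker, P.ker_eq]
  exact Subgroup.subset_normalClosure (mem_image_of_mem _ hr)

/-- The vertices of the edge path at `1` which reads the word `w`. -/
def verts : List (S × Bool) → Set G
  | [] => {1}
  | l :: w => insert 1 ((P.letter l * ·) '' verts w)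

theorem one_mem_verts (w : List (S × Bool)) : (1 : G) ∈ P.verts w := by
  cases w <;> simp [verts]

theorem finite_verts (w : List (S × Bool)) : (P.verts w).Finite := by
  induction w with
  | nil => simp [verts]
  | cons l w ih => exact (ih.image _).insert _

theorem letter_mul_mem_verts {l : S × Bool} {w : List (S × Bool)} {k : G} (hk : k ∈ P.verts w) :
    P.letter l * k ∈ P.verts (l :: w) := Or.inr ⟨k, hk, rfl⟩

/-- A map on the cells which is compatible with the gluing of edges to vertices. -/
structure SkeletonMap {T : Type*} [TopologicalSpace T] (ψ : P.Cells → T) : Prop where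
  source (g : G) (s : S) : ψ (P.edgeCell g s 0) = ψ (P.vertexCell g)
  target (g : G) (s : S) : ψ (P.edgeCell g s 1) = ψ (P.vertexCell (g * P.val s))
  cont (g : G) (s : S) : Continuous fun x => ψ (P.edgeCell g s x)

namespace SkeletonMap

variable {P} {T : Type*} [TopologicalSpace T] {ψ : P.Cells → T} (hψ : P.SkeletonMap ψ)

theorem step_zero (hψ : P.SkeletonMap ψ) (g : G) (l : S × Bool) :
    ψ (P.stepCell g l 0) = ψ (P.vertexCell g) := by
  unfold stepCell
  split_ifs
  · exact hψ.source _ _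
  · simp [hψ.target]

theorem step_one (hψ : P.SkeletonMap ψ) (g : G) (l : S × Bool) :
    ψ (P.stepCell g l 1) = ψ (P.vertexCell (g * P.letter l)) := by
  unfold stepCell letter
  split_ifs
  · exact hψ.target _ _
  · simp [hψ.source]

theorem continuous_step (hψ : P.SkeletonMap ψ) (g : G) (l : S × Bool) :
    Continuous fun x => ψ (P.stepCell g l x) := by
  unfold stepCell
  split_ifs
  · exact hψ.cont _ _
  · exact (hψ.cont _ _).comp unitInterval.continuous_symm

theorem word_of_nonpos (hψ : P.SkeletonMap ψ) (g : G) (w : List (S × Bool)) {y : ℝ} (hy : y ≤ 0) :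
    ψ (P.wordCell g w y) = ψ (P.vertexCell g) := by
  cases w with
  | nil => rfl
  | cons l w =>
    rw [wordCell, if_pos (by linarith), projIcc_of_le_left _ hy]
    exact hψ.step_zero g l

theorem word_of_length_le (hψ : P.SkeletonMap ψ) (g : G) (w : List (S × Bool)) {y : ℝ}
    (hy : w.length ≤ y) : ψ (P.wordCell g w y) = ψ (P.vertexCell (g * P.wordVal w)) := by
  induction w generalizing g y with
  | nil => simp [wordCell]
  | cons l w ih =>
    simp only [List.length_cons, Nat.cast_add, Nat.cast_one] at hy
    rw [wordCell, wordVal_cons, ← mul_assoc]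
    split_ifs with h
    · have hy1 : y = 1 := le_antisymm h (by linarith [(Nat.cast_nonneg w.length : (0 : ℝ) ≤ _)])
      rw [← ih (g * P.letter l) (y := 0) (by linarith), projIcc_of_right_le _ hy1.ge,
        hψ.word_of_nonpos _ _ le_rfl]
      exact hψ.step_one g l
    · exact ih _ (by linarith)

theorem continuous_word (hψ : P.SkeletonMap ψ) (g : G) (w : List (S × Bool)) :
    Continuous fun y => ψ (P.wordCell g w y) := by
  induction w generalizing g with
  | nil => exact (continuous_const : Continuous fun _ : ℝ => ψ (P.vertexCell g))
  | cons l w ih =>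
    simp only [wordCell, apply_ite ψ]
    refine Continuous.if_le ((hψ.continuous_step g l).comp continuous_projIcc)
      ((ih (g * P.letter l)).comp (continuous_id.sub continuous_const)) continuous_id
      continuous_const ?_
    rintro y rfl
    rw [sub_self, projIcc_right, hψ.word_of_nonpos _ _ le_rfl]
    exact hψ.step_one g l

theorem word_append (hψ : P.SkeletonMap ψ) (g : G) (u w : List (S × Bool)) (y : ℝ) :
    ψ (P.wordCell g (u ++ w) y) = if y ≤ u.length then ψ (P.wordCell g u y)
      else ψ (P.wordCell (g * P.wordVal u) w (y - u.length)) := by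
  induction u generalizing g y with
  | nil =>
    split_ifs with h
    · exact hψ.word_of_nonpos _ _ (by simpa using h)
    · simp
  | cons l u ih =>
    simp only [List.cons_append, wordCell, List.length_cons, Nat.cast_add, Nat.cast_one,
      wordVal_cons, apply_ite ψ]
    rw [ih, ← mul_assoc]
    have hu : (0 : ℝ) ≤ u.length := Nat.cast_nonneg _
    by_cases h1 : y ≤ 1
    · rw [if_pos h1, if_pos (by linarith), if_pos h1]
    · by_cases h2 : y - 1 ≤ u.length
      · rw [if_neg h1, if_pos h2, if_pos (by linarith), if_neg h1]
      · rw [if_neg h1, if_neg h2, if_neg (by linarith)]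
        congr 2; ring

end SkeletonMap

/-! ### Extending functions from the 1-skeleton to the faces -/

section Extension

variable {E : Type*} [NormedAddCommGroup E]

/-- A function on the 1-skeleton, given by its values on vertices and edges, as a function on the
cells. -/
def skeletonFun (V : G → E) (W : G → S → ℝ → E) : P.Cells → E
  | Sum.inl c => V c.1
  | Sum.inr (Sum.inl c) => W c.1.1 c.1.2 (c.2 : ℝ)
  | Sum.inr (Sum.inr _) => 0

variable {P} {V : G → E} {W : G → S → ℝ → E}

theorem skeletonMap_skeletonFun (hW : ∀ g s, Continuous (W g s)) (h0 : ∀ g s, W g s 0 = V g)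
    (h1 : ∀ g s, W g s 1 = V (g * P.val s)) : P.SkeletonMap (P.skeletonFun V W) where
  source g s := by simp [skeletonFun, edgeCell, vertexCell, h0]
  target g s := by simp [skeletonFun, edgeCell, vertexCell, h1]
  cont g s := (hW g s).comp continuous_subtype_val

/-- A relator has value `1`, so its edge path is a loop; this is what allows the radial extension
over the disc. -/
theorem boundary_closed (hψ : P.SkeletonMap (P.skeletonFun V W)) (g : G) (r : P.rels) :
    (fun y : ℝ => P.skeletonFun V W (P.wordCell g r.1 (y * r.1.length))) 0
      = (fun y : ℝ => P.skeletonFun V W (P.wordCell g r.1 (y * r.1.length))) 1 := by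
  dsimp only
  rw [hψ.word_of_nonpos g r.1 (by simp), hψ.word_of_length_le g r.1 (by simp),
    P.wordVal_relator r.2, mul_one]

variable [NormedSpace ℝ E]

variable (P) in
/-- The function on the cells that agrees with a given function on the 1-skeleton, and on faces is
its radial extension plus a given function `c`. -/
def extensionFun (V : G → E) (W : G → S → ℝ → E) (c : G × P.rels → ℂ → E) : P.Cells → E
  | Sum.inl a => V a.1
  | Sum.inr (Sum.inl a) => W a.1.1 a.1.2 (a.2 : ℝ)
  | Sum.inr (Sum.inr a) =>
      radial (fun y => P.skeletonFun V W (P.wordCell a.1.1 a.1.2.1 (y * a.1.2.1.length))) a.2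
        + c a.1 a.2

variable {c : G × P.rels → ℂ → E}

theorem extensionFun_stepCell (g : G) (l : S × Bool) (x : unitInterval) :
    P.extensionFun V W c (P.stepCell g l x) = P.skeletonFun V W (P.stepCell g l x) := by
  unfold stepCell
  split_ifs <;> rfl

theorem extensionFun_wordCell (g : G) (w : List (S × Bool)) (y : ℝ) :
    P.extensionFun V W c (P.wordCell g w y) = P.skeletonFun V W (P.wordCell g w y) := by
  induction w generalizing g y with
  | nil => rfl
  | cons l w ih =>
    unfold wordCell
    split_ifs
    · exact extensionFun_stepCell _ _ _
    · exact ih _ _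

theorem extensionFun_glue (hψ : P.SkeletonMap (P.skeletonFun V W))
    (hc : ∀ a z, ‖z‖ = 1 → c a z = 0) {p q : P.Cells} (h : P.Glue p q) :
    P.extensionFun V W c p = P.extensionFun V W c q := by
  cases h with
  | source g s => exact hψ.source g s
  | target g s => exact hψ.target g s
  | boundary g r z x hz =>
    have hz1 : ‖(z : ℂ)‖ = 1 := by
      rw [hz, show (2 * Real.pi * (x : ℝ) * Complex.I : ℂ) = ((2 * Real.pi * x : ℝ) : ℂ) * Complex.I
        by push_cast; ring]
      exact Complex.norm_exp_ofReal_mul_I _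
    rw [extensionFun_wordCell]
    simp only [faceCell, extensionFun, hc _ _ hz1, add_zero]
    rw [hz]
    exact radial_exp (boundary_closed hψ g r) x.2

/-- The continuous function on the Cayley 2-complex that a function on the 1-skeleton and
functions on the faces define. -/
def extension (hψ : P.SkeletonMap (P.skeletonFun V W)) (hc : ∀ a z, ‖z‖ = 1 → c a z = 0) :
    P.CayleyComplex → E :=
  Quot.lift (P.extensionFun V W c) fun _ _ => extensionFun_glue hψ hc

theorem continuous_extension (hψ : P.SkeletonMap (P.skeletonFun V W))
    (hc : ∀ a z, ‖z‖ = 1 → c a z = 0) (hcc : ∀ a, Continuous (c a)) :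
    Continuous (extension hψ hc) := by
  refine continuous_quot_lift _ ?_
  refine continuous_sum_dom.2 ⟨?_, continuous_sum_dom.2 ⟨?_, ?_⟩⟩
  · exact continuous_sigma fun g => continuous_of_discreteTopology
  · exact continuous_sigma fun a => hψ.cont a.1 a.2
  · refine continuous_sigma fun a => ?_
    have hb : Continuous fun y : ℝ =>
        P.skeletonFun V W (P.wordCell a.1 a.2.1 (y * a.2.1.length)) :=
      (hψ.continuous_word a.1 a.2.1).comp (continuous_id.mul continuous_const)
    exact ((continuous_radial hb (boundary_closed hψ a.1 a.2)).add (hcc a)).comp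
      continuous_subtype_val

end Extension

/-! ### Separating points of the complex by continuous functions -/

/-- The vertex `g` as a point of the Cayley 2-complex. -/
def vertexPt (g : G) : P.CayleyComplex := Quot.mk P.Glue (P.vertexCell g)

theorem continuous_mk : Continuous (Quot.mk P.Glue : P.Cells → P.CayleyComplex) :=
  continuous_quot_mk

theorem skeletonMap_mk : P.SkeletonMap (Quot.mk P.Glue : P.Cells → P.CayleyComplex) where
  source g s := Quot.sound (Glue.source g s)
  target g s := Quot.sound (Glue.target g s)
  cont g s := by
    refine P.continuous_mk.comp ?_
    exact continuous_inr.comp (continuous_inl.comp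
      (continuous_sigmaMk (σ := fun _ : G × S => unitInterval)))

/-- Every point of the Cayley 2-complex lies in an open cell. -/
theorem exists_open_cell (p : P.CayleyComplex) : (∃ g, p = P.vertexPt g) ∨
    (∃ g s, ∃ x : unitInterval, 0 < (x : ℝ) ∧ (x : ℝ) < 1 ∧ p = Quot.mk P.Glue (P.edgeCell g s x)) ∨
    ∃ g r, ∃ z : Metric.closedBall (0 : ℂ) 1, ‖(z : ℂ)‖ < 1 ∧
      p = Quot.mk P.Glue (P.faceCell g r z) := by
  have hedge : ∀ g s x, (∃ h, Quot.mk P.Glue (P.edgeCell g s x) = P.vertexPt h) ∨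
      ∃ g' s', ∃ x' : unitInterval, 0 < (x' : ℝ) ∧ (x' : ℝ) < 1 ∧
        Quot.mk P.Glue (P.edgeCell g s x) = Quot.mk P.Glue (P.edgeCell g' s' x') := by
    intro g s x
    rcases x.2.1.eq_or_lt with h0 | h0
    · left
      obtain rfl : x = 0 := Subtype.ext h0.symm
      exact ⟨g, P.skeletonMap_mk.source g s⟩
    rcases x.2.2.eq_or_lt with h1 | h1
    · left
      obtain rfl : x = 1 := Subtype.ext h1
      exact ⟨_, P.skeletonMap_mk.target g s⟩
    exact Or.inr ⟨g, s, x, h0, h1, rfl⟩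
  have hword : ∀ w g y, (∃ h, Quot.mk P.Glue (P.wordCell g w y) = P.vertexPt h) ∨
      ∃ g' s', ∃ x' : unitInterval, 0 < (x' : ℝ) ∧ (x' : ℝ) < 1 ∧
        Quot.mk P.Glue (P.wordCell g w y) = Quot.mk P.Glue (P.edgeCell g' s' x') := by
    intro w
    induction w with
    | nil => exact fun g y => Or.inl ⟨g, rfl⟩
    | cons l w ih =>
      intro g y
      unfold wordCell
      split_ifs
      · unfold stepCell
        split_ifs
        exacts [hedge _ _ _, hedge _ _ _]
      · exact ih _ _
  obtain ⟨c, rfl⟩ := Quot.exists_rep p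
  rcases c with ⟨g, -⟩ | ⟨⟨g, s⟩, x⟩ | ⟨⟨g, r⟩, z⟩
  · exact Or.inl ⟨g, rfl⟩
  · rcases hedge g s x with h | h
    exacts [Or.inl h, Or.inr (Or.inl h)]
  · have hz : ‖(z : ℂ)‖ ≤ 1 := by simpa only [mem_closedBall_zero_iff] using z.2
    rcases hz.eq_or_lt with hz | hz
    · obtain ⟨x, hx⟩ : ∃ x : unitInterval,
          (z : ℂ) = Complex.exp (2 * Real.pi * (x : ℝ) * Complex.I) := by
        have : Fact (0 < 2 * Real.pi) := ⟨Real.two_pi_pos⟩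
        obtain ⟨θ, hθ, he⟩ := AddCircle.eq_coe_Ico (p := 2 * Real.pi) ((z : ℂ).arg : Real.Angle)
        refine ⟨⟨θ / (2 * Real.pi), div_nonneg hθ.1 Real.two_pi_pos.le,
          (div_le_one Real.two_pi_pos).2 hθ.2.le⟩, ?_⟩
        have h1 := Complex.norm_mul_exp_arg_mul_I (z : ℂ)
        rw [hz, Complex.ofReal_one, one_mul] at h1
        obtain ⟨n, hn⟩ := Real.Angle.angle_eq_iff_two_pi_dvd_sub.1
          (show ((z : ℂ).arg : Real.Angle) = (θ : Real.Angle) from he.symm)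
        have h2 : (z : ℂ).arg = θ + n * (2 * Real.pi) := by linarith
        have hpi : (Real.pi : ℂ) ≠ 0 := by exact_mod_cast Real.pi_ne_zero
        rw [← h1, h2]
        push_cast
        rw [show (2 * Real.pi * (θ / (2 * Real.pi)) * Complex.I : ℂ) = θ * Complex.I by field_simp,
          add_mul, Complex.exp_add, mul_assoc, Complex.exp_int_mul_two_pi_mul_I, mul_one]
      have h : Quot.mk P.Glue (P.faceCell g r z) = _ := Quot.sound (Glue.boundary g r z x hx)
      rcases hword r.1 g ((x : ℝ) * r.1.length) with h' | h'
      · rw [← h] at h'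
        exact Or.inl h'
      · rw [← h] at h'
        exact Or.inr (Or.inl h')
    · exact Or.inr (Or.inr ⟨g, r, z, hz, rfl⟩)

open scoped Classical in
/-- The barycentric coordinate of the vertex `h`: it is linear on edges, and each face is a cone on
its boundary whose centre is the base vertex of the face. -/
theorem exists_bary (h : G) : ∃ f : P.CayleyComplex → ℝ, Continuous f ∧
    (∀ g, f (P.vertexPt g) = if g = h then 1 else 0) ∧
    (∀ g s x, f (Quot.mk P.Glue (P.edgeCell g s x)) =
      (1 - x) * (if g = h then 1 else 0) + x * if g * P.val s = h then 1 else 0) ∧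
    ∀ g (r : P.rels) z, f (Quot.mk P.Glue (P.faceCell g r z)) =
      radial (fun y => f (Quot.mk P.Glue (P.wordCell g r.1 (y * r.1.length)))) z
        + (1 - ‖(z : ℂ)‖) * if g = h then 1 else 0 := by
  let V : G → ℝ := fun g => if g = h then 1 else 0
  let W : G → S → ℝ → ℝ := fun g s x => (1 - x) * V g + x * V (g * P.val s)
  -- The radial extension alone vanishes at the centre of a disc. The added term gives the base
  -- vertex a positive coordinate throughout the open disc.
  let c : G × P.rels → ℂ → ℝ := fun a z => (1 - ‖z‖) * V a.1
  have hψ : P.SkeletonMap (P.skeletonFun V W) :=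
    skeletonMap_skeletonFun (fun g s => by fun_prop) (by simp [W]) (by simp [W])
  have hc : ∀ a z, ‖z‖ = 1 → c a z = 0 := fun a z hz => by simp [c, hz]
  refine ⟨extension hψ hc, continuous_extension hψ hc fun a => by fun_prop, fun g => rfl,
    fun g s x => rfl, fun g r z => ?_⟩
  simp only [extension, extensionFun_wordCell]
  rfl

-- The first component `x(1 - x)` vanishes at both ends, so extension by zero to the other edges is
-- continuous, and it is positive inside the chosen edge; the quotient of the components recovers
-- `x` there.
open scoped Classical in
theorem exists_edge_fun (g₀ : G) (s₀ : S) : ∃ f : P.CayleyComplex → ℝ × ℝ, Continuous f ∧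
    (∀ g, f (P.vertexPt g) = 0) ∧
    ∀ g s (x : unitInterval), f (Quot.mk P.Glue (P.edgeCell g s x)) =
      if (g, s) = (g₀, s₀) then ((x * (1 - x), x * (x * (1 - x))) : ℝ × ℝ) else 0 := by
  let W : G → S → ℝ → ℝ × ℝ := fun g s x =>
    if (g, s) = (g₀, s₀) then ((x * (1 - x), x * (x * (1 - x))) : ℝ × ℝ) else 0
  have hψ : P.SkeletonMap (P.skeletonFun 0 W) :=
    skeletonMap_skeletonFun (fun g s => by
      by_cases hgs : (g, s) = (g₀, s₀) <;> simp only [W, hgs, if_true, if_false] <;> fun_prop)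
      (by simp [W]) (by simp [W])
  have hc : ∀ (a : G × P.rels) (z : ℂ), ‖z‖ = 1 → (fun _ _ => 0 : G × P.rels → ℂ → ℝ × ℝ) a z = 0 :=
    fun a z hz => rfl
  exact ⟨extension hψ hc, continuous_extension hψ hc fun a => by fun_prop, fun g => rfl,
    fun g s x => rfl⟩

-- The factor `1 - ‖z‖` vanishes on the boundary circle and is positive inside the chosen disc,
-- where the pair determines `z`.
open scoped Classical in
theorem exists_face_fun (g₀ : G) (r₀ : P.rels) : ∃ f : P.CayleyComplex → ℝ × ℂ, Continuous f ∧
    (∀ g, f (P.vertexPt g) = 0) ∧ (∀ g s x, f (Quot.mk P.Glue (P.edgeCell g s x)) = 0) ∧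
    ∀ g r (z : Metric.closedBall (0 : ℂ) 1), f (Quot.mk P.Glue (P.faceCell g r z)) =
      if (g, r) = (g₀, r₀) then (1 - ‖(z : ℂ)‖) • ((1, (z : ℂ)) : ℝ × ℂ) else 0 := by
  let c : G × P.rels → ℂ → ℝ × ℂ := fun a z =>
    if a = (g₀, r₀) then (1 - ‖z‖) • ((1, z) : ℝ × ℂ) else 0
  have hψ : P.SkeletonMap (P.skeletonFun (0 : G → ℝ × ℂ) 0) :=
    skeletonMap_skeletonFun (fun g s => continuous_const) (by simp) (by simp)
  have hc : ∀ a z, ‖z‖ = 1 → c a z = 0 := fun a z hz => by simp [c, hz]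
  refine ⟨extension hψ hc, continuous_extension hψ hc fun a => ?_, fun g => rfl,
    fun g s x => rfl, fun g r z => ?_⟩
  · by_cases ha : a = (g₀, r₀) <;> simp only [c, ha, if_true, if_false] <;> fun_prop
  · have h0 : ∀ a : P.Cells, P.skeletonFun (0 : G → ℝ × ℂ) 0 a = 0 := by
      rintro (_ | _ | _) <;> rfl
    have h1 : extension hψ hc (Quot.mk P.Glue (P.faceCell g r z)) = radial (fun y =>
      P.skeletonFun (0 : G → ℝ × ℂ) 0 (P.wordCell g r.1 (y * r.1.length))) z + c (g, r) z := rfl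
    have h2 : radial (fun _ : ℝ => (0 : ℝ × ℂ)) z = 0 := by
      rw [radial]
      exact smul_zero _
    rw [h1]
    simp only [h0, h2, zero_add, c]

/-- Continuous functions to Hausdorff spaces separate points, with cells treated in decreasing
dimension: the face functions single out points of open faces, the edge functions those of open
edges within the 1-skeleton, and the barycentric coordinates distinguish vertices. -/
instance : T2Space P.CayleyComplex := by
  classical
  have hsep : ∀ p q : P.CayleyComplex, (∀ f : P.CayleyComplex → ℝ × ℂ, Continuous f → f p = f q) →
      (∀ f : P.CayleyComplex → ℝ × ℝ, Continuous f → f p = f q) →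
      (∀ f : P.CayleyComplex → ℝ, Continuous f → f p = f q) → p = q := by
    intro p q h1 h2 h3
    have hface : ∀ p q : P.CayleyComplex, (∀ f : P.CayleyComplex → ℝ × ℂ, Continuous f → f p = f q) →
        ∀ g r, ∀ z : Metric.closedBall (0 : ℂ) 1, ‖(z : ℂ)‖ < 1 →
          p = Quot.mk P.Glue (P.faceCell g r z) → p = q := by
      rintro p q h g r z hz rfl
      obtain ⟨f, hf, hf0, hf1, hf2⟩ := P.exists_face_fun g r
      have e := h f hf
      rw [hf2, if_pos rfl] at e
      rcases P.exists_open_cell q with ⟨g', rfl⟩ | ⟨g', s', x', -, -, rfl⟩ | ⟨g', r', z', hz', rfl⟩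
      · rw [hf0] at e
        have := congrArg Prod.fst e
        simp at this
        linarith
      · rw [hf1] at e
        have := congrArg Prod.fst e
        simp at this
        linarith
      · rw [hf2] at e
        split_ifs at e with he
        · obtain ⟨rfl, rfl⟩ := Prod.mk.inj he
          have e1 : 1 - ‖(z : ℂ)‖ = 1 - ‖(z' : ℂ)‖ := by simpa using congrArg Prod.fst e
          have e2 := congrArg Prod.snd e
          rw [← e1] at e2
          have hne : 1 - ‖(z : ℂ)‖ ≠ 0 := by linarith
          have e3 : (z : ℂ) = z' := smul_right_injective ℂ hne e2
          rw [Subtype.ext e3]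
        · have := congrArg Prod.fst e
          simp at this
          linarith
    have hedge : ∀ p q : P.CayleyComplex, (∀ f : P.CayleyComplex → ℝ × ℝ, Continuous f → f p = f q) →
        ((∃ g, q = P.vertexPt g) ∨ ∃ g s, ∃ x : unitInterval,
          0 < (x : ℝ) ∧ (x : ℝ) < 1 ∧ q = Quot.mk P.Glue (P.edgeCell g s x)) →
        ∀ g s, ∀ x : unitInterval, 0 < (x : ℝ) → (x : ℝ) < 1 →
          p = Quot.mk P.Glue (P.edgeCell g s x) → p = q := by
      rintro p q h hq g s x hx0 hx1 rfl
      obtain ⟨f, hf, hf0, hf1⟩ := P.exists_edge_fun g s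
      have e := h f hf
      have hpos : 0 < (x : ℝ) * (1 - x) := mul_pos hx0 (by linarith)
      rw [hf1, if_pos rfl] at e
      rcases hq with ⟨g', rfl⟩ | ⟨g', s', x', -, -, rfl⟩
      · rw [hf0] at e
        have : (x : ℝ) * (1 - x) = 0 := congrArg Prod.fst e
        linarith
      · rw [hf1] at e
        split_ifs at e with he
        · obtain ⟨rfl, rfl⟩ := Prod.mk.inj he
          have e1 : (x : ℝ) * (1 - x) = x' * (1 - x') := congrArg Prod.fst e
          have e2 : (x : ℝ) * (x * (1 - x)) = x' * (x' * (1 - x')) := congrArg Prod.snd e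
          rw [← e1] at e2
          rw [Subtype.ext (mul_right_cancel₀ hpos.ne' e2)]
        · have : (x : ℝ) * (1 - x) = 0 := congrArg Prod.fst e
          linarith
    rcases P.exists_open_cell p with hp | hp | ⟨g, r, z, hz, hp⟩
    · rcases P.exists_open_cell q with hq | ⟨g, s, x, hx0, hx1, hq⟩ | ⟨g, r, z, hz, hq⟩
      · obtain ⟨g, rfl⟩ := hp
        obtain ⟨g', rfl⟩ := hq
        obtain ⟨f, hf, hf0, -⟩ := P.exists_bary g
        have e := h3 f hf
        rw [hf0, hf0, if_pos rfl] at e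
        by_cases hg : g' = g
        · rw [hg]
        · simp [hg] at e
      · exact (hedge q p (fun f hf => (h2 f hf).symm) (Or.inl hp) g s x hx0 hx1 hq).symm
      · exact (hface q p (fun f hf => (h1 f hf).symm) g r z hz hq).symm
    · rcases P.exists_open_cell q with hq | hq | ⟨g, r, z, hz, hq⟩
      · obtain ⟨g, s, x, hx0, hx1, hp⟩ := hp
        exact hedge p q h2 (Or.inl hq) g s x hx0 hx1 hp
      · obtain ⟨g, s, x, hx0, hx1, hp⟩ := hp
        exact hedge p q h2 (Or.inr hq) g s x hx0 hx1 hp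
      · exact (hface q p (fun f hf => (h1 f hf).symm) g r z hz hq).symm
    · exact hface p q h1 g r z hz hp
  refine ⟨fun p q hpq => ?_⟩
  by_contra hne
  refine hpq (hsep p q (fun f hf => ?_) (fun f hf => ?_) (fun f hf => ?_)) <;>
  · by_contra h
    exact hne (separated_by_continuous hf h)

end FinitePresentation

/-! ### Homotopies of edge paths with controlled support -/

namespace FinitePresentation

open Set Topology

variable {G : Type*} [Group G] {S : Type*} (P : FinitePresentation G S)

/-- The barycentric coordinate of the vertex `h` on the Cayley 2-complex. -/
def bary (h : G) : P.CayleyComplex → ℝ := (P.exists_bary h).choose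

theorem continuous_bary (h : G) : Continuous (P.bary h) := (P.exists_bary h).choose_spec.1

open scoped Classical in
theorem bary_vertex (h g : G) : P.bary h (P.vertexPt g) = if g = h then 1 else 0 :=
  (P.exists_bary h).choose_spec.2.1 g

open scoped Classical in
theorem bary_edge (h g : G) (s : S) (x : unitInterval) :
    P.bary h (Quot.mk P.Glue (P.edgeCell g s x)) =
      (1 - x) * (if g = h then 1 else 0) + x * if g * P.val s = h then 1 else 0 :=
  (P.exists_bary h).choose_spec.2.2.1 g s x

open scoped Classical in
theorem bary_face (h g : G) (r : P.rels) (z : Metric.closedBall (0 : ℂ) 1) :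
    P.bary h (Quot.mk P.Glue (P.faceCell g r z)) =
      radial (fun y => P.bary h (Quot.mk P.Glue (P.wordCell g r.1 (y * r.1.length)))) z
        + (1 - ‖(z : ℂ)‖) * if g = h then 1 else 0 :=
  (P.exists_bary h).choose_spec.2.2.2 g r z

/-- The points all of whose non-zero barycentric coordinates belong to vertices in `E`. -/
def full (E : Set G) : Set P.CayleyComplex := {p | ∀ h, P.bary h p ≠ 0 → h ∈ E}

theorem full_mono {E F : Set G} (h : E ⊆ F) : P.full E ⊆ P.full F :=
  fun _ hp k hk => h (hp k hk)

theorem vertexPt_mem_full {E : Set G} {g : G} (hg : g ∈ E) : P.vertexPt g ∈ P.full E := by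
  intro h hh
  rw [bary_vertex] at hh
  obtain rfl : g = h := by by_contra hne; simp [hne] at hh
  exact hg

theorem edge_mem_full {E : Set G} {g : G} {s : S} (hg : g ∈ E) (hs : g * P.val s ∈ E)
    (x : unitInterval) : Quot.mk P.Glue (P.edgeCell g s x) ∈ P.full E := by
  intro h hh
  rw [bary_edge] at hh
  by_cases h1 : g = h
  · exact h1 ▸ hg
  by_cases h2 : g * P.val s = h
  · exact h2 ▸ hs
  simp [h1, h2] at hh

theorem step_mem_full {E : Set G} {g : G} {l : S × Bool} (hg : g ∈ E) (hl : g * P.letter l ∈ E)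
    (x : unitInterval) : Quot.mk P.Glue (P.stepCell g l x) ∈ P.full E := by
  unfold stepCell
  unfold letter at hl
  split_ifs at hl ⊢
  · exact P.edge_mem_full hg hl _
  · exact P.edge_mem_full hl (by simpa using hg) _

theorem word_mem_full {E : Set G} {g : G} {w : List (S × Bool)}
    (hw : ∀ k ∈ P.verts w, g * k ∈ E) (y : ℝ) : Quot.mk P.Glue (P.wordCell g w y) ∈ P.full E := by
  induction w generalizing g y with
  | nil => exact P.vertexPt_mem_full (by simpa using hw 1 (P.one_mem_verts _))
  | cons l w ih =>
    unfold wordCell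
    split_ifs
    · refine P.step_mem_full (by simpa using hw 1 (P.one_mem_verts _)) ?_ _
      simpa using hw _ (P.letter_mul_mem_verts (P.one_mem_verts w))
    · refine ih (fun k hk => ?_) _
      rw [mul_assoc]
      exact hw _ (P.letter_mul_mem_verts hk)

theorem face_mem_full {E : Set G} {g : G} {r : P.rels} (hr : ∀ k ∈ P.verts r.1, g * k ∈ E)
    (z : Metric.closedBall (0 : ℂ) 1) : Quot.mk P.Glue (P.faceCell g r z) ∈ P.full E := by
  intro h hh
  rw [bary_face] at hh
  by_cases h1 : g = h
  · subst h1
    simpa using hr 1 (P.one_mem_verts _)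
  · rw [if_neg h1, mul_zero, add_zero] at hh
    obtain ⟨x, -, hx⟩ := exists_ne_zero_of_radial_ne_zero hh
    exact P.word_mem_full hr _ h hx

theorem bary_edge_nonneg (h g : G) (s : S) (x : unitInterval) :
    0 ≤ P.bary h (Quot.mk P.Glue (P.edgeCell g s x)) := by
  classical
  rw [bary_edge]
  have h0 := x.2.1
  have h1 := sub_nonneg.2 x.2.2
  refine add_nonneg (mul_nonneg h1 ?_) (mul_nonneg h0 ?_) <;> split_ifs <;> simp

theorem bary_word_nonneg (h g : G) (w : List (S × Bool)) (y : ℝ) :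
    0 ≤ P.bary h (Quot.mk P.Glue (P.wordCell g w y)) := by
  induction w generalizing g y with
  | nil =>
    change 0 ≤ P.bary h (P.vertexPt g)
    rw [bary_vertex]
    split_ifs <;> simp
  | cons l w ih =>
    unfold wordCell stepCell
    split_ifs
    exacts [P.bary_edge_nonneg _ _ _ _, P.bary_edge_nonneg _ _ _ _, ih _ _]

/-- The base vertex of the open cell works: its own term is positive and the remaining contributions
are nonnegative. Thus the sets `bary h ≠ 0` form an open cover, on which both compactness and
properness arguments rest. -/
theorem exists_bary_ne_zero (p : P.CayleyComplex) : ∃ h, P.bary h p ≠ 0 := by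
  classical
  rcases P.exists_open_cell p with ⟨g, rfl⟩ | ⟨g, s, x, hx0, hx1, rfl⟩ | ⟨g, r, z, hz, rfl⟩
  · exact ⟨g, by simp [bary_vertex]⟩
  · refine ⟨g, ?_⟩
    rw [bary_edge, if_pos rfl]
    split_ifs <;> linarith
  · refine ⟨g, ?_⟩
    rw [bary_face, if_pos rfl]
    have : 0 ≤ radial (fun y => P.bary g (Quot.mk P.Glue (P.wordCell g r.1 (y * r.1.length)))) z :=
      smul_nonneg (norm_nonneg _) (P.bary_word_nonneg _ _ _ _)
    linarith

/-- A compact set meets only finitely many open stars of vertices in a suitable cover. -/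
theorem exists_finite_of_isCompact {C : Set P.CayleyComplex} (hC : IsCompact C) :
    ∃ E : Set G, E.Finite ∧ ∀ p ∈ C, ∃ h ∈ E, P.bary h p ≠ 0 := by
  obtain ⟨E, hE⟩ := hC.elim_finite_subcover (fun h => {p | P.bary h p ≠ 0})
    (fun h => isOpen_ne_fun (P.continuous_bary h) continuous_const)
    (fun p _ => mem_iUnion.2 (P.exists_bary_ne_zero p))
  refine ⟨E, E.finite_toSet, fun p hp => ?_⟩
  obtain ⟨h, hh, hp⟩ := mem_iUnion₂.1 (hE hp)
  exact ⟨h, hh, hp⟩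

/-! ### Fillings between words -/

/-- The edge path that starts at `g` and reads the word `w`, as a Moore path. -/
def path (g : G) (w : List (S × Bool)) (y : ℝ) : P.CayleyComplex :=
  Quot.mk P.Glue (P.wordCell g w y)

theorem continuous_path (g : G) (w : List (S × Bool)) : Continuous (P.path g w) :=
  P.skeletonMap_mk.continuous_word g w

theorem path_of_nonpos (g : G) (w : List (S × Bool)) {y : ℝ} (hy : y ≤ 0) :
    P.path g w y = P.vertexPt g := P.skeletonMap_mk.word_of_nonpos g w hy

theorem path_of_length_le (g : G) (w : List (S × Bool)) {y : ℝ} (hy : w.length ≤ y) :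
    P.path g w y = P.vertexPt (g * P.wordVal w) := P.skeletonMap_mk.word_of_length_le g w hy

theorem path_append (g : G) (u w : List (S × Bool)) :
    P.path g (u ++ w) = fun y : ℝ => if y ≤ u.length then P.path g u y
      else P.path (g * P.wordVal u) w (y - u.length) :=
  funext fun y => P.skeletonMap_mk.word_append g u w y

/-- The words `u` and `w` have the same value, and for each `g` the edge paths at `g` which read
them are homotopic in the part of the Cayley 2-complex that is spanned by `g K`. -/
def Fill (K : Set G) (u w : List (S × Bool)) : Prop :=
  P.wordVal u = P.wordVal w ∧ ∀ g, MooreHomotopic (P.full {h | g⁻¹ * h ∈ K}) (P.vertexPt g)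
    (P.vertexPt (g * P.wordVal u)) (P.path g u) u.length (P.path g w) w.length

namespace Fill

variable {P} {K L : Set G} {u v w u' w' : List (S × Bool)}

theorem mono (h : P.Fill K u w) (hKL : K ⊆ L) : P.Fill L u w :=
  ⟨h.1, fun g => (h.2 g).mono (P.full_mono fun _ hk => hKL hk)⟩

variable (P) in
theorem refl (w : List (S × Bool)) : P.Fill (P.verts w) w w :=
  ⟨rfl, fun g => MooreHomotopic.refl (P.continuous_path g w) (Nat.cast_nonneg _)
    (fun _ hy => P.path_of_nonpos g w hy) (fun _ hy => P.path_of_length_le g w hy)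
    (P.word_mem_full fun k hk => by simpa using hk)⟩

theorem symm (h : P.Fill K u w) : P.Fill K w u :=
  ⟨h.1.symm, fun g => by rw [← h.1]; exact (h.2 g).symm⟩

theorem trans (h : P.Fill K u v) (h' : P.Fill K v w) : P.Fill K u w :=
  ⟨h.1.trans h'.1, fun g => (h.2 g).trans (by rw [h.1]; exact h'.2 g)⟩

theorem append (h : P.Fill K u w) (h' : P.Fill L u' w') :
    P.Fill (K ∪ (P.wordVal u * ·) '' L) (u ++ u') (w ++ w') := by
  refine ⟨by simp [h.1, h'.1], fun g => ?_⟩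
  rw [path_append, path_append, wordVal_append, ← mul_assoc, List.length_append,
    List.length_append, Nat.cast_add, Nat.cast_add, ← h.1]
  refine ((h.2 g).mono (P.full_mono fun k hk => Or.inl hk)).concat
    ((h'.2 (g * P.wordVal u)).mono (P.full_mono fun k hk => Or.inr ⟨_, hk, ?_⟩))
  simp [mul_assoc]

end Fill

theorem stepCell_inv (g : G) (s : S) (b : Bool) (x : unitInterval) :
    P.stepCell (g * P.letter (s, b)) (s, !b) x = P.stepCell g (s, b) (unitInterval.symm x) := by
  cases b <;> simp [stepCell, letter]

theorem wordVal_cancel (s : S) (b : Bool) : P.wordVal [(s, b), (s, !b)] = 1 := by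
  cases b <;> simp [wordVal, letter]

/-- The backtracking is retracted along its edge: for `s` in `[0,1]`, the path at stage `s` goes out
to parameter `1 - s` and returns, whence the position `min y (2(1 - s) - y)` for `y` in `[0, 2(1 -
s)]`. -/
theorem fill_cancel (s : S) (b : Bool) : P.Fill (P.verts [(s, b)]) [(s, b), (s, !b)] [] := by
  refine ⟨P.wordVal_cancel s b, fun g => ?_⟩
  rw [P.wordVal_cancel, mul_one]
  have hs : ∀ {y : ℝ}, y ≤ 0 →
      Quot.mk P.Glue (P.stepCell g (s, b) (projIcc 0 1 zero_le_one y)) = P.vertexPt g := by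
    intro y hy
    rw [projIcc_of_le_left _ hy]
    exact P.skeletonMap_mk.step_zero g (s, b)
  refine ⟨fun z => Quot.mk P.Glue (P.stepCell g (s, b)
    (projIcc 0 1 zero_le_one (min z.1 (2 * (1 - z.2) - z.1)))), fun s => max 0 (2 * (1 - s)),
    ?_, by fun_prop, fun _ => le_max_left _ _, by norm_num, by norm_num, ?_, ?_, ?_, ?_, ?_⟩
  · exact (P.skeletonMap_mk.continuous_step g (s, b)).comp
      (continuous_projIcc.comp (by fun_prop))
  · intro y
    simp only [path, wordCell]
    split_ifs with h1 h2
    · rw [min_eq_left (by linarith)]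
    · rw [P.stepCell_inv, min_eq_right (by linarith)]
      congr 2
      have h3 : y - 1 ∈ Icc (0 : ℝ) 1 := ⟨by linarith, h2⟩
      rw [projIcc_of_mem _ h3, projIcc_of_mem _ (⟨by linarith, by linarith⟩ :
        2 * (1 - 0) - y ∈ Icc (0 : ℝ) 1)]
      ext
      simp only [unitInterval.coe_symm_eq]
      ring
    · rw [hs ((min_le_right _ _).trans (by linarith))]
      have h3 := P.wordVal_cancel s b
      simp only [wordVal_cons, wordVal_nil, mul_one] at h3
      rw [mul_assoc, h3, mul_one]
      rfl
  · intro y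
    refine hs ?_
    rcases le_total y 0 with h | h
    · exact (min_le_left _ _).trans h
    · exact (min_le_right _ _).trans (by linarith)
  · exact fun _ y hy => hs ((min_le_left _ _).trans hy)
  · exact fun t y hy => hs ((min_le_right _ _).trans (by linarith [(le_max_right _ _).trans hy]))
  · refine fun z => P.step_mem_full ?_ ?_ _
    · simpa using P.one_mem_verts _
    · simpa using P.letter_mul_mem_verts (P.one_mem_verts [])

/-- By convexity the boundary loop contracts inside the disc along straight segments to the base
point `1`, which is glued to the vertex `g`. -/
theorem fill_relator (r : P.rels) : P.Fill (P.verts r.1) r.1 [] := by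
  by_cases hr : r.1 = []
  · rw [hr]
    exact Fill.refl P _
  have hn : (0 : ℝ) < r.1.length := by exact_mod_cast List.length_pos_iff.2 hr
  refine ⟨P.wordVal_relator r.2, fun g => ?_⟩
  rw [P.wordVal_relator r.2, mul_one]
  let x : ℝ × ℝ → unitInterval := fun z => projIcc 0 1 zero_le_one (z.1 / r.1.length)
  let σ : ℝ × ℝ → unitInterval := fun z => projIcc 0 1 zero_le_one z.2
  let e : ℝ × ℝ → ℂ := fun z => Complex.exp (2 * Real.pi * (x z : ℝ) * Complex.I)
  let f : ℝ × ℝ → ℂ := fun z => ((σ z : ℝ) : ℂ) + (1 - ((σ z : ℝ) : ℂ)) * e z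
  have hx : Continuous x := continuous_projIcc.comp (by fun_prop)
  have hσ : Continuous σ := continuous_projIcc.comp (by fun_prop)
  have he : ∀ z, ‖e z‖ = 1 := fun z => by
    simp only [e]
    rw [show (2 * Real.pi * (x z : ℝ) * Complex.I : ℂ)
      = ((2 * Real.pi * x z : ℝ) : ℂ) * Complex.I by push_cast; ring]
    exact Complex.norm_exp_ofReal_mul_I _
  have hf : ∀ z, f z ∈ Metric.closedBall (0 : ℂ) 1 := fun z => by
    rw [mem_closedBall_zero_iff]
    have h0 := (σ z).2.1
    have h1 := sub_nonneg.2 (σ z).2.2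
    refine (norm_add_le _ _).trans ?_
    rw [norm_mul, he, mul_one, ← Complex.ofReal_one, ← Complex.ofReal_sub, Complex.norm_real,
      Complex.norm_real, Real.norm_of_nonneg h0, Real.norm_of_nonneg h1]
    linarith
  have hfc : Continuous f := by fun_prop
  have hbase : ∀ z, f z = 1 → Quot.mk P.Glue (P.faceCell g r ⟨f z, hf z⟩) = P.vertexPt g := by
    intro z hz
    refine (Quot.sound (Glue.boundary g r ⟨f z, hf z⟩ 0 (by simp [hz]))).trans ?_
    exact P.path_of_nonpos g r.1 (by simp)
  -- The contraction ends in a constant path that still lasts `r.1.length`; the second homotopy only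
  -- shortens its duration to `0`.
  refine MooreHomotopic.trans (δ := fun _ => P.vertexPt g) (n := r.1.length) ?_ ?_
  · refine ⟨fun z => Quot.mk P.Glue (P.faceCell g r ⟨f z, hf z⟩), fun _ => r.1.length, ?_,
      continuous_const, fun _ => hn.le, rfl, rfl, ?_, ?_, ?_, ?_, ?_⟩
    · refine P.continuous_mk.comp (continuous_inr.comp (continuous_inr.comp
        ((continuous_sigmaMk (σ := fun _ : G × P.rels => Metric.closedBall (0 : ℂ) 1)).comp
          (hfc.subtype_mk hf))))
    · intro y
      have hσ0 : σ (y, 0) = 0 := projIcc_left _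
      refine (Quot.sound (Glue.boundary g r ⟨f (y, 0), hf _⟩ (x (y, 0)) (by
        simp [f, e, hσ0]))).trans ?_
      change P.path g r.1 _ = P.path g r.1 y
      rcases le_total y 0 with hy | hy
      · rw [P.path_of_nonpos g r.1 hy]
        have : x (y, 0) = 0 := projIcc_of_le_left _ (div_nonpos_of_nonpos_of_nonneg hy hn.le)
        rw [this]
        exact P.path_of_nonpos g r.1 (by simp)
      rcases le_total (r.1.length : ℝ) y with hy' | hy'
      · rw [P.path_of_length_le g r.1 hy']
        have : x (y, 0) = 1 := projIcc_of_right_le _ ((one_le_div hn).2 hy')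
        rw [this]
        exact P.path_of_length_le g r.1 (by simp)
      · congr 1
        have : (x (y, 0) : ℝ) = y / r.1.length := by
          simp only [x]
          rw [projIcc_of_mem _ ⟨div_nonneg hy hn.le, (div_le_one hn).2 hy'⟩]
        rw [this]
        field_simp
    · intro y
      have hσ1 : σ (y, 1) = 1 := projIcc_right _
      exact hbase _ (by simp [f, hσ1])
    · intro s y hy
      have : x (y, s) = 0 := projIcc_of_le_left _ (div_nonpos_of_nonpos_of_nonneg hy hn.le)
      exact hbase _ (by simp [f, e, this])
    · intro s y hy
      have : x (y, s) = 1 := projIcc_of_right_le _ ((one_le_div hn).2 hy)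
      exact hbase _ (by simp [f, e, this])
    · exact fun z => P.face_mem_full (by simp) _
  · exact ⟨fun _ => P.vertexPt g, fun s => |1 - s| * r.1.length, continuous_const, by fun_prop,
      fun s => by positivity, by simp, by simp, fun _ => rfl, fun _ => rfl, fun _ _ _ => rfl,
      fun _ _ _ => rfl, fun _ => P.vertexPt_mem_full (by simpa using P.one_mem_verts _)⟩

/-! ### Words with the same value are boundedly homotopic -/

/-- The relation that edge paths with labels `u` and `w` are homotopic within a bounded distance of
their initial vertex. -/
def Equivalent (u w : List (S × Bool)) : Prop := ∃ K : Set G, K.Finite ∧ P.Fill K u w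

namespace Equivalent

variable {P} {u v w u' w' : List (S × Bool)}

variable (P) in
theorem refl (w : List (S × Bool)) : P.Equivalent w w := ⟨_, P.finite_verts w, Fill.refl P w⟩

theorem symm (h : P.Equivalent u w) : P.Equivalent w u := by
  obtain ⟨K, hK, h⟩ := h
  exact ⟨K, hK, h.symm⟩

theorem trans (h : P.Equivalent u v) (h' : P.Equivalent v w) : P.Equivalent u w := by
  obtain ⟨K, hK, h⟩ := h
  obtain ⟨L, hL, h'⟩ := h'
  exact ⟨K ∪ L, hK.union hL, (h.mono subset_union_left).trans (h'.mono subset_union_right)⟩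

theorem append (h : P.Equivalent u w) (h' : P.Equivalent u' w') :
    P.Equivalent (u ++ u') (w ++ w') := by
  obtain ⟨K, hK, h⟩ := h
  obtain ⟨L, hL, h'⟩ := h'
  exact ⟨_, hK.union (hL.image _), h.append h'⟩

theorem of_red (h : FreeGroup.Red u w) : P.Equivalent u w := by
  induction h with
  | refl => exact refl P u
  | tail _ hs ih =>
    refine ih.trans ?_
    cases hs with
    | @not L₁ L₂ s b =>
      have h := ((refl P L₁).append ⟨_, P.finite_verts _, P.fill_cancel s b⟩).append (refl P L₂)
      simpa using h

theorem of_mk_eq (h : FreeGroup.mk u = FreeGroup.mk w) : P.Equivalent u w := by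
  obtain ⟨v, h1, h2⟩ := FreeGroup.Red.exact.1 h
  exact (of_red h1).trans (of_red h2).symm

theorem invRev_append (w : List (S × Bool)) : P.Equivalent (FreeGroup.invRev w ++ w) [] := by
  refine of_mk_eq ?_
  rw [← FreeGroup.mul_mk, ← FreeGroup.inv_mk, inv_mul_cancel]
  rfl

theorem append_invRev (w : List (S × Bool)) : P.Equivalent (w ++ FreeGroup.invRev w) [] := by
  refine of_mk_eq ?_
  rw [← FreeGroup.mul_mk, ← FreeGroup.inv_mk, mul_inv_cancel]
  rfl

variable (P) in
/-- The elements of the free group whose words are null-homotopic. -/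
def nullSubgroup : Subgroup (FreeGroup S) where
  carrier := {a | ∃ u, FreeGroup.mk u = a ∧ P.Equivalent u []}
  one_mem' := ⟨[], rfl, refl P _⟩
  mul_mem' := by
    rintro _ _ ⟨u, rfl, hu⟩ ⟨w, rfl, hw⟩
    exact ⟨u ++ w, FreeGroup.mul_mk.symm, hu.append hw⟩
  inv_mem' := by
    rintro _ ⟨u, rfl, hu⟩
    refine ⟨FreeGroup.invRev u, FreeGroup.inv_mk.symm, ?_⟩
    have h := (refl P (FreeGroup.invRev u)).append hu
    rw [List.append_nil] at h
    exact h.symm.trans (invRev_append u)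

instance : (nullSubgroup P).Normal where
  conj_mem := by
    rintro _ ⟨u, rfl, hu⟩ g
    induction g using Quot.inductionOn with
    | _ w =>
      refine ⟨w ++ u ++ FreeGroup.invRev w, ?_, ?_⟩
      · rw [← FreeGroup.mul_mk, ← FreeGroup.mul_mk, ← FreeGroup.inv_mk]
        rfl
      · have h := ((refl P w).append hu).append (refl P (FreeGroup.invRev w))
        rw [List.append_nil] at h
        exact h.trans (append_invRev w)

/-- Words with the same value are equivalent. -/
theorem of_wordVal_eq (h : P.wordVal u = P.wordVal w) : P.Equivalent u w := by
  -- The null-homotopic words define a normal subgroup containing the relators, hence the whole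
  -- kernel.
  have hle : (FreeGroup.lift P.val).ker ≤ nullSubgroup P := by
    rw [P.ker_eq]
    refine Subgroup.normalClosure_le_normal ?_
    rintro _ ⟨r, hr, rfl⟩
    exact ⟨r, rfl, _, P.finite_verts r, P.fill_relator ⟨r, hr⟩⟩
  have hmem : FreeGroup.mk (u ++ FreeGroup.invRev w) ∈ (FreeGroup.lift P.val).ker := by
    rw [MonoidHom.mem_ker, ← FreeGroup.mul_mk, map_mul, ← FreeGroup.inv_mk, map_inv,
      ← P.wordVal_eq_lift, ← P.wordVal_eq_lift, h, mul_inv_cancel]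
  obtain ⟨v, hv, hv'⟩ := hle hmem
  have h1 := ((of_mk_eq hv).symm.trans hv').append (refl P w)
  have h2 := (refl P u).append (invRev_append (P := P) w)
  rw [List.append_nil] at h2
  rw [List.append_assoc] at h1
  exact h2.symm.trans h1

end Equivalent

end FinitePresentation

namespace FinitePresentation

open Set Topology

variable {G : Type*} [Group G] {S : Type*} (P : FinitePresentation G S)

/-! ### Homotopies with control at infinity -/

/-- The rays `r` and `s` are homotopic relative to their initial point in the complement of `C`,
and the homotopy meets each open star of a vertex only in a bounded part of its domain. -/
def TameHomotopic (C : Set P.CayleyComplex) (r s : ℝ≥0 → P.CayleyComplex) : Prop :=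
  ∃ H : ℝ≥0 × unitInterval → P.CayleyComplex, Continuous H ∧ (∀ x, H (x, 0) = r x) ∧
    (∀ x, H (x, 1) = s x) ∧ (∀ y, H (0, y) = r 0) ∧ (∀ p, H p ∉ C) ∧
    ∀ h, ∃ M : ℝ≥0, ∀ p, P.bary h (H p) ≠ 0 → p.1 ≤ M

namespace TameHomotopic

variable {P} {C : Set P.CayleyComplex} {r s q : ℝ≥0 → P.CayleyComplex}

theorem symm (h : P.TameHomotopic C r s) : P.TameHomotopic C s r := by
  obtain ⟨H, hc, h0, h1, hb, hC, hM⟩ := h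
  refine ⟨fun p => H (p.1, unitInterval.symm p.2), by fun_prop, by simpa, by simpa, fun y => ?_,
    fun p => hC _, fun g => ?_⟩
  · dsimp only
    rw [← h1, hb, hb]
  · obtain ⟨M, hM⟩ := hM g
    exact ⟨M, fun p hp => hM (p.1, unitInterval.symm p.2) hp⟩

theorem trans (h : P.TameHomotopic C r s) (h' : P.TameHomotopic C s q) :
    P.TameHomotopic C r q := by
  obtain ⟨H, hc, h0, h1, hb, hC, hM⟩ := h
  obtain ⟨H', hc', h0', h1', hb', hC', hM'⟩ := h'
  have hrs : r 0 = s 0 := by rw [← h1, hb]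
  refine ⟨fun p => if (p.2 : ℝ) ≤ 1 / 2 then H (p.1, projIcc 0 1 zero_le_one (2 * p.2))
    else H' (p.1, projIcc 0 1 zero_le_one (2 * p.2 - 1)), ?_, ?_, ?_, ?_, ?_, ?_⟩
  · have c1 : Continuous fun p : ℝ≥0 × unitInterval => projIcc (0 : ℝ) 1 zero_le_one (2 * p.2) :=
      continuous_projIcc.comp (by fun_prop)
    have c2 : Continuous fun p : ℝ≥0 × unitInterval =>
        projIcc (0 : ℝ) 1 zero_le_one (2 * p.2 - 1) := continuous_projIcc.comp (by fun_prop)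
    refine Continuous.if_le (by fun_prop) (by fun_prop) (by fun_prop) (by fun_prop) ?_
    intro p hp
    have e1 : projIcc (0 : ℝ) 1 zero_le_one (2 * p.2) = 1 :=
      projIcc_of_right_le _ (by rw [hp]; norm_num)
    have e2 : projIcc (0 : ℝ) 1 zero_le_one (2 * p.2 - 1) = 0 :=
      projIcc_of_le_left _ (by rw [hp]; norm_num)
    rw [e1, e2, h1, h0']
  · intro x
    have e : projIcc (0 : ℝ) 1 zero_le_one (2 * (0 : unitInterval)) = 0 :=
      projIcc_of_le_left _ (by simp)
    dsimp only
    rw [if_pos (by norm_num), e, h0]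
  · intro x
    have e : projIcc (0 : ℝ) 1 zero_le_one (2 * (1 : unitInterval) - 1) = 1 :=
      projIcc_of_right_le _ (by norm_num)
    dsimp only
    rw [if_neg (by norm_num), e, h1']
  · intro y
    dsimp only
    split_ifs
    exacts [hb _, by rw [hb', hrs]]
  · intro p
    dsimp only
    split_ifs
    exacts [hC _, hC' _]
  · intro g
    obtain ⟨M, hM⟩ := hM g
    obtain ⟨M', hM'⟩ := hM' g
    refine ⟨max M M', fun p hp => ?_⟩
    dsimp only at hp
    split_ifs at hp
    · have h := hM _ hp
      exact le_max_of_le_left h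
    · have h := hM' _ hp
      exact le_max_of_le_right h

/-- The open stars cover the complex, and the preimage of each lies in a compact strip `[0, M] × [0,
1]`. -/
theorem properlyHomotopic (h : P.TameHomotopic C r s) : ProperlyHomotopicRelAvoiding C r s := by
  obtain ⟨H, hc, h0, h1, hb, hC, hM⟩ := h
  refine ⟨H, isProperMap_of_nhds_preimage_subset_compact hc fun p => ?_, h0, h1, hb, hC⟩
  obtain ⟨g, hg⟩ := P.exists_bary_ne_zero p
  obtain ⟨M, hM⟩ := hM g
  refine ⟨{p | P.bary g p ≠ 0},
    (isOpen_ne_fun (P.continuous_bary g) continuous_const).mem_nhds hg, Icc 0 M ×ˢ univ,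
    isCompact_Icc.prod isCompact_univ, fun z hz => ⟨⟨zero_le, hM z hz⟩, mem_univ _⟩⟩

end TameHomotopic

/-! ### Pushing words along the stable letter -/

theorem exists_word_of_mem_closure {𝒜 : Set S} {a : G} (ha : a ∈ Subgroup.closure (P.val '' 𝒜)) :
    ∃ w : List (S × Bool), (∀ l ∈ w, l.1 ∈ 𝒜) ∧ P.wordVal w = a := by
  induction ha using Subgroup.closure_induction with
  | mem x hx =>
    obtain ⟨s, hs, rfl⟩ := hx
    exact ⟨[(s, true)], by simpa using hs, by simp [letter]⟩
  | one => exact ⟨[], by simp, rfl⟩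
  | mul x y _ _ hx hy =>
    obtain ⟨u, hu, rfl⟩ := hx
    obtain ⟨w, hw, rfl⟩ := hy
    exact ⟨u ++ w, fun l hl => (List.mem_append.1 hl).elim (hu l) (hw l), by simp⟩
  | inv x _ hx =>
    obtain ⟨u, hu, rfl⟩ := hx
    refine ⟨FreeGroup.invRev u, fun l hl => ?_, ?_⟩
    · simp only [FreeGroup.invRev, List.mem_reverse, List.mem_map] at hl
      obtain ⟨m, hm, rfl⟩ := hl
      exact hu m hm
    · rw [wordVal_eq_lift, ← FreeGroup.inv_mk, map_inv, ← wordVal_eq_lift]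

theorem exists_word (g : G) : ∃ w, P.wordVal w = g := by
  obtain ⟨a, rfl⟩ := P.surjective g
  induction a using Quot.inductionOn with
  | _ w => exact ⟨w, P.wordVal_eq_lift w⟩

theorem letter_mem {A : Subgroup G} {𝒜 : Set S} (hA : ∀ s ∈ 𝒜, P.val s ∈ A) {l : S × Bool}
    (hl : l.1 ∈ 𝒜) : P.letter l ∈ A := by
  unfold letter
  split_ifs
  exacts [hA _ hl, A.inv_mem (hA _ hl)]

theorem verts_subset {A : Subgroup G} {𝒜 : Set S} (hA : ∀ s ∈ 𝒜, P.val s ∈ A)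
    {w : List (S × Bool)} (hw : ∀ l ∈ w, l.1 ∈ 𝒜) : P.verts w ⊆ A := by
  induction w with
  | nil => simp [verts]
  | cons l w ih =>
    rintro _ (rfl | ⟨k, hk, rfl⟩)
    · exact A.one_mem
    · exact A.mul_mem (P.letter_mem hA (hw l (by simp)))
        (ih (fun m hm => hw m (List.mem_cons_of_mem _ hm)) hk)

/-- The word which arises from the letter `l` by substituting `j` times according to `σ`. -/
def pushed (σ : S × Bool → List (S × Bool)) (l : S × Bool) : ℕ → List (S × Bool)
  | 0 => [l]
  | j + 1 => (pushed σ l j).flatMap σ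

section Pushing

variable {P} {𝒜 : Set S} {t : G} {σ : S × Bool → List (S × Bool)}

theorem pushed_letters (hσ : ∀ l : S × Bool, l.1 ∈ 𝒜 → ∀ m ∈ σ l, m.1 ∈ 𝒜) {l : S × Bool}
    (hl : l.1 ∈ 𝒜) (j : ℕ) : ∀ m ∈ pushed σ l j, m.1 ∈ 𝒜 := by
  induction j with
  | zero => simpa [pushed] using hl
  | succ j ih =>
    intro m hm
    obtain ⟨k, hk, hm⟩ := List.mem_flatMap.1 hm
    exact hσ k (ih k hk) m hm

theorem wordVal_flatMap (hσt : ∀ l : S × Bool, l.1 ∈ 𝒜 → P.wordVal (σ l) = t⁻¹ * P.letter l * t)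
    {w : List (S × Bool)} (hw : ∀ l ∈ w, l.1 ∈ 𝒜) :
    P.wordVal (w.flatMap σ) = t⁻¹ * P.wordVal w * t := by
  induction w with
  | nil => simp
  | cons l w ih =>
    rw [List.flatMap_cons, wordVal_append, ih fun m hm => hw m (List.mem_cons_of_mem _ hm),
      hσt l (hw l (by simp)), wordVal_cons]
    group

/-- This is `a * t ^ j = t ^ j * φ^j(a)`. It makes the strips over consecutive edges of a ray meet
at every height. -/
theorem pow_mul_wordVal_pushed (hσ : ∀ l : S × Bool, l.1 ∈ 𝒜 → ∀ m ∈ σ l, m.1 ∈ 𝒜)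
    (hσt : ∀ l : S × Bool, l.1 ∈ 𝒜 → P.wordVal (σ l) = t⁻¹ * P.letter l * t) {l : S × Bool}
    (hl : l.1 ∈ 𝒜) (j : ℕ) : t ^ j * P.wordVal (pushed σ l j) = P.letter l * t ^ j := by
  induction j with
  | zero => simp [pushed]
  | succ j ih =>
    rw [pushed, wordVal_flatMap hσt (pushed_letters hσ hl j), pow_succ]
    simp only [mul_assoc, mul_inv_cancel_left]
    rw [← mul_assoc, ih, mul_assoc]

/-- The squares between a word and the word that arises by pushing it along the stable letter can
be filled at a bounded depth. -/
theorem exists_fill_pushed (lev : G →* Multiplicative ℤ)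
    (hlev : ∀ s ∈ 𝒜, lev (P.val s) = 1) (hlevt : lev t = Multiplicative.ofAdd 1)
    (hσ : ∀ l : S × Bool, l.1 ∈ 𝒜 → ∀ m ∈ σ l, m.1 ∈ 𝒜)
    (hσt : ∀ l : S × Bool, l.1 ∈ 𝒜 → P.wordVal (σ l) = t⁻¹ * P.letter l * t)
    {T : List (S × Bool)} (hT : P.wordVal T = t) :
    ∃ R : ℕ, ∀ l : S × Bool, l.1 ∈ 𝒜 → ∀ j, ∃ K : Set G, K.Finite ∧
      (∀ k ∈ K, -(R : ℤ) ≤ (lev k).toAdd) ∧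
      P.Fill K (pushed σ l j ++ T) (T ++ pushed σ l (j + 1)) := by
  have := P.finite_gens
  have hletter : ∀ l : S × Bool, ∃ K : Set G, K.Finite ∧
      (l.1 ∈ 𝒜 → P.Fill K ([l] ++ T) (T ++ σ l)) := by
    intro l
    by_cases hl : l.1 ∈ 𝒜
    · obtain ⟨K, hK, h⟩ := Equivalent.of_wordVal_eq (P := P) (u := [l] ++ T) (w := T ++ σ l)
        (by simp [hσt l hl, hT, mul_assoc])
      exact ⟨K, hK, fun _ => h⟩
    · exact ⟨∅, finite_empty, fun h => absurd h hl⟩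
  choose K hK hKf using hletter
  have hfin : ((⋃ l, K l) ∪ P.verts T).Finite := (finite_iUnion hK).union (P.finite_verts T)
  -- The depth bound is read off from one filling per letter, finitely many in all, before any word
  -- is chosen; this is why it does not depend on `j`.
  obtain ⟨b, hb⟩ := (hfin.image fun k => (lev k).toAdd).bddBelow
  have hb' : ∀ k ∈ (⋃ l, K l) ∪ P.verts T, -(b.natAbs : ℤ) ≤ (lev k).toAdd := fun k hk => by
    have := hb ⟨k, hk, rfl⟩
    dsimp only at this
    omega
  have hker : ∀ s ∈ 𝒜, P.val s ∈ lev.ker := fun s hs => hlev s hs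
  have key : ∀ u : List (S × Bool), (∀ l ∈ u, l.1 ∈ 𝒜) → ∃ L : Set G, L.Finite ∧
      (∀ k ∈ L, -(b.natAbs : ℤ) ≤ (lev k).toAdd) ∧ P.Fill L (u ++ T) (T ++ u.flatMap σ) := by
    intro u
    induction u with
    | nil => exact fun _ => ⟨P.verts T, P.finite_verts T, fun k hk => hb' k (Or.inr hk), by
        simpa using Fill.refl P T⟩
    | cons l u ih =>
      intro hu
      have hl := hu l (by simp)
      have hu' : ∀ m ∈ u, m.1 ∈ 𝒜 := fun m hm => hu m (List.mem_cons_of_mem _ hm)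
      obtain ⟨L, hL, hLb, hLf⟩ := ih hu'
      have hlk : lev (P.letter l) = 1 := P.letter_mem hker hl
      -- The letter `T` passes in two moves, from `l u T` to `l T σ(u)` and then to `T σ(l) σ(u)`.
      -- The first filling is translated by `l`, of level `0`, so its depth is unchanged.
      have h1 := (Fill.refl P [l]).append hLf
      have h2 := (hKf l hl).append (Fill.refl P (u.flatMap σ))
      refine ⟨_, ((P.finite_verts [l]).union (hL.image (P.wordVal [l] * ·))).union ((hK l).union
        ((P.finite_verts (u.flatMap σ)).image (P.wordVal ([l] ++ T) * ·))), ?_, ?_⟩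
      rotate_left
      · refine (h1.mono subset_union_left).trans (v := [l] ++ (T ++ u.flatMap σ)) ?_
        have h3 := h2.mono (subset_union_right (s := P.verts [l] ∪ (P.wordVal [l] * ·) '' L))
        simpa only [List.append_assoc, List.flatMap_cons] using h3
      · rintro k ((hk | ⟨k, hk, rfl⟩) | (hk | ⟨k, hk, rfl⟩))
        · have : lev k = 1 := P.verts_subset hker (w := [l]) (by simpa using hl) hk
          rw [this, toAdd_one]
          omega
        · simpa [hlk] using hLb k hk
        · exact hb' k (Or.inl (mem_iUnion.2 ⟨l, hk⟩))
        · have : lev k = 1 := by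
            refine P.verts_subset hker (w := u.flatMap σ) (fun m hm => ?_) hk
            obtain ⟨n, hn, hm⟩ := List.mem_flatMap.1 hm
            exact hσ n (hu' n hn) m hm
          simp only [wordVal_append, wordVal_cons, wordVal_nil, map_mul, mul_one, this,
            hlk, hT, hlevt, one_mul, toAdd_ofAdd]
          omega
  exact ⟨b.natAbs, fun l hl j => key _ (pushed_letters hσ hl j)⟩

end Pushing

/-! ### The quadrant spanned by a ray and the stable letter -/

theorem path_append_left (g : G) (u w : List (S × Bool)) {y : ℝ} (hy : y ≤ u.length) :
    P.path g (u ++ w) y = P.path g u y := by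
  rw [path_append]
  exact if_pos hy

theorem path_append_right (g : G) (u w : List (S × Bool)) {y : ℝ} (hy : 0 ≤ y) :
    P.path g (u ++ w) (u.length + y) = P.path (g * P.wordVal u) w y := by
  rw [path_append]
  dsimp only
  split_ifs with h
  · obtain rfl : y = 0 := by linarith
    rw [P.path_of_length_le g u (by simp), P.path_of_nonpos _ w le_rfl]
  · rw [add_sub_cancel_left]

/-- A homotopy between the words `u T` and `T u'` as a map of the unit square. -/
theorem Fill.exists_square {P : FinitePresentation G S} {K : Set G} {u u' T : List (S × Bool)}
    (h : P.Fill K (u ++ T) (T ++ u')) (hT : (0 : ℝ) < T.length) (g : G) :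
    ∃ Q : ℝ × ℝ → P.CayleyComplex, ContinuousOn Q (Icc 0 1 ×ˢ Icc 0 1) ∧
      (∀ x ∈ Icc (0 : ℝ) 1, Q (x, 0) = P.path g u (x * u.length)) ∧
      (∀ y ∈ Icc (0 : ℝ) 1, Q (1, y) = P.path (g * P.wordVal u) T (y * T.length)) ∧
      (∀ y ∈ Icc (0 : ℝ) 1, Q (0, y) = P.path g T (y * T.length)) ∧
      (∀ x ∈ Icc (0 : ℝ) 1, Q (x, 1) = P.path (g * P.wordVal T) u' (x * u'.length)) ∧
      ∀ z, Q z ∈ P.full {h | g⁻¹ * h ∈ K} := by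
  have hg := h.2 g
  rw [List.length_append, List.length_append, Nat.cast_add, Nat.cast_add] at hg
  obtain ⟨Q, hc, h1, h2, h3, h4, h5⟩ := hg.exists_square (Nat.cast_nonneg _) (Nat.cast_nonneg _) hT
  refine ⟨Q, hc, fun x hx => ?_, fun y hy => ?_, fun y hy => ?_, fun x hx => ?_, h5⟩
  · rw [h1 x hx, P.path_append_left]
    exact mul_le_of_le_one_left (Nat.cast_nonneg _) hx.2
  · rw [h2 y hy, P.path_append_right _ _ _ (mul_nonneg hy.1 hT.le)]
  · rw [h3 y hy, P.path_append_left]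
    exact mul_le_of_le_one_left (Nat.cast_nonneg _) hy.2
  · rw [h4 x hx, P.path_append_right _ _ _ (mul_nonneg hx.1 (Nat.cast_nonneg _))]

/-- The ray at `v` which runs through the word `T` in each unit of time, over and over. -/
def periodicRay (T : List (S × Bool)) (v : G) (y : ℝ≥0) : P.CayleyComplex :=
  P.path (v * P.wordVal T ^ ⌊y⌋₊) T (((y : ℝ) - ⌊y⌋₊) * T.length)

theorem path_singleton (g : G) (l : S × Bool) {y : ℝ} (hy : y ≤ 1) :
    P.path g [l] y = Quot.mk P.Glue (P.stepCell g l (projIcc 0 1 zero_le_one y)) := by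
  simp only [path, wordCell, hy, if_true]
  rfl

theorem ray_eq_path (v : G) (l : ℕ → S × Bool) (y : ℝ≥0) :
    P.ray v l y = P.path (P.rayVertex v l ⌊y⌋₊) [l ⌊y⌋₊] ((y : ℝ) - ⌊y⌋₊) :=
  (P.path_singleton _ _ (sub_mem_unit (mem_floor_interval y)).2).symm

theorem ray_natCast (v : G) (l : ℕ → S × Bool) (i : ℕ) :
    P.ray v l i = P.vertexPt (P.rayVertex v l i) := by
  rw [ray_eq_path, Nat.floor_natCast]
  exact P.path_of_nonpos _ _ (by simp)

theorem rayVertex_const (v : G) (l : S × Bool) (i : ℕ) :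
    P.rayVertex v (fun _ => l) i = v * P.letter l ^ i := by
  induction i with
  | zero => simp [rayVertex]
  | succ i ih => rw [rayVertex, ih, pow_succ, mul_assoc]

theorem periodicRay_singleton (v : G) (l : S × Bool) :
    P.periodicRay [l] v = P.ray v fun _ => l := by
  funext y
  rw [ray_eq_path, rayVertex_const, periodicRay]
  simp

/-- A vertex lies on a proper ray only finitely often. -/
theorem finite_setOf_rayVertex_eq {v : G} {l : ℕ → S × Bool} (h : IsProperMap (P.ray v l)) (b : G) :
    {i | P.rayVertex v l i = b}.Finite := by
  obtain ⟨M, hM⟩ := (h.isCompact_preimage (isCompact_singleton (x := P.vertexPt b))).bddAbove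
  refine (finite_Iic ⌊M⌋₊).subset fun i hi => Nat.le_floor (hM ?_)
  rw [mem_preimage, ray_natCast, show P.rayVertex v l i = b from hi]
  rfl

/-- A proper ray in `g A` that avoids a suitable compact set can be pushed along the stable letter
in the complement of a given compact set. -/
theorem exists_compact_tameHomotopic {A : Subgroup G} {𝒜 : Set S} {t : G}
    (hA : Subgroup.closure (P.val '' 𝒜) = A) (hconj : ∀ a ∈ A, t⁻¹ * a * t ∈ A)
    (lev : G →* Multiplicative ℤ) (hlev : ∀ a ∈ A, lev a = 1)
    (hlevt : lev t = Multiplicative.ofAdd 1) (g : G) {T : List (S × Bool)} (hT : P.wordVal T = t)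
    {C : Set P.CayleyComplex} (hC : IsCompact C) :
    ∃ D : Set P.CayleyComplex, IsCompact D ∧ ∀ (v : G) (l : ℕ → S × Bool),
      P.IsProperRayIn A 𝒜 g D v l → P.TameHomotopic C (P.ray v l) (P.periodicRay T v) := by
  have := P.finite_gens
  have hval : ∀ s ∈ 𝒜, P.val s ∈ A := fun s hs => by
    rw [← hA]
    exact Subgroup.subset_closure (mem_image_of_mem _ hs)
  have hTpos : (0 : ℝ) < T.length := by
    have : T ≠ [] := by
      rintro rfl
      rw [wordVal_nil] at hT
      rw [← hT, map_one] at hlevt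
      exact absurd hlevt (by decide)
    exact_mod_cast List.length_pos_iff.2 this
  have hσ : ∀ l : S × Bool, ∃ w : List (S × Bool), l.1 ∈ 𝒜 →
      (∀ m ∈ w, m.1 ∈ 𝒜) ∧ P.wordVal w = t⁻¹ * P.letter l * t := by
    intro l
    by_cases hl : l.1 ∈ 𝒜
    · obtain ⟨w, hw⟩ := P.exists_word_of_mem_closure
        (hA.symm ▸ hconj _ (P.letter_mem hval hl) : t⁻¹ * P.letter l * t ∈ _)
      exact ⟨w, fun _ => hw⟩
    · exact ⟨[], fun h => absurd h hl⟩
  choose σ hσ using hσ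
  have hσ1 : ∀ l : S × Bool, l.1 ∈ 𝒜 → ∀ m ∈ σ l, m.1 ∈ 𝒜 := fun l hl => (hσ l hl).1
  have hσt : ∀ l : S × Bool, l.1 ∈ 𝒜 → P.wordVal (σ l) = t⁻¹ * P.letter l * t :=
    fun l hl => (hσ l hl).2
  obtain ⟨R, hR⟩ := exists_fill_pushed lev (fun s hs => hlev _ (hval s hs)) hlevt hσ1 hσt hT
  choose! K hK hKR hKf using hR
  let N : ℤ := (lev g).toAdd
  -- the vertices of level `N` from which a vertex of `E` is met in the course of pushing
  let B : Set G → Set G := fun E => {b | (lev b).toAdd = N ∧ ∃ h ∈ E, ∃ (j : ℕ) (l : S × Bool),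
    l.1 ∈ 𝒜 ∧ (b * t ^ j)⁻¹ * h ∈ K l j}
  -- The base `b * t ^ j` has level `N + j` and the filling descends at most `R` below it, so a
  -- fixed `h` can be met only for bounded `j`.
  have hJ : ∀ (b h : G) (j : ℕ) (l : S × Bool), (lev b).toAdd = N → l.1 ∈ 𝒜 →
      (b * t ^ j)⁻¹ * h ∈ K l j → j ≤ ((lev h).toAdd - N + R).toNat := by
    intro b h j l hb hl hk
    have := hKR l hl j _ hk
    simp only [map_mul, map_inv, map_pow, hlevt, toAdd_mul, toAdd_inv, toAdd_pow, toAdd_ofAdd,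
      hb] at this
    simp only [nsmul_eq_mul, mul_one] at this
    omega
  -- The vertex `b` is recovered as `h * k⁻¹ * (t ^ j)⁻¹`, with finitely many choices of `h`, `j`,
  -- `l` and `k`.
  have hB : ∀ E : Set G, E.Finite → (B E).Finite := by
    intro E hE
    refine (hE.biUnion fun h _ => (finite_Iic ((lev h).toAdd - N + R).toNat).biUnion fun j _ =>
      (toFinite {l : S × Bool | l.1 ∈ 𝒜}).biUnion fun l hl =>
        (hK l hl j).image fun k => h * k⁻¹ * (t ^ j)⁻¹).subset ?_
    rintro b ⟨hb, h, hh, j, l, hl, hk⟩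
    simp only [mem_iUnion]
    exact ⟨h, hh, j, hJ b h j l hb hl hk, l, hl, _, hk, by group⟩
  obtain ⟨E, hE, hCE⟩ := P.exists_finite_of_isCompact hC
  -- A finite set of vertices suffices as `D`: whether the pushed strips meet `C` is decided by the
  -- vertices of the ray, all of level `N`.
  refine ⟨P.vertexPt '' B E, ((hB E hE).image _).isCompact, fun v l hl => ?_⟩
  let V : ℕ → G := P.rayVertex v l
  have hV : ∀ i, V (i + 1) = V i * P.letter (l i) := fun i => rfl
  have hVN : ∀ i, (lev (V i)).toAdd = N := by
    intro i
    induction i with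
    | zero =>
      obtain ⟨a, ha, rfl⟩ := hl.base
      simp [V, rayVertex, hlev a ha, N]
    | succ i ih =>
      rw [hV, map_mul, hlev _ (P.letter_mem hval (hl.labels i)), mul_one, ih]
  have hVB : ∀ i, V i ∉ B E := fun i hi =>
    hl.avoids i (by rw [ray_natCast]; exact mem_image_of_mem _ hi)
  -- The square `(i, j)` is based at `V i * t ^ j`; `hh` and `hv` match it with its right and upper
  -- neighbours.
  choose Q hQc hQ1 hQ2 hQ3 hQ4 hQ5 using fun i j =>
    (hKf (l i) (hl.labels i) j).exists_square hTpos (V i * t ^ j)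
  have hh : ∀ i j, ∀ y ∈ Icc (0 : ℝ) 1, Q i j (1, y) = Q (i + 1) j (0, y) := fun i j y hy => by
    rw [hQ2 i j y hy, hQ3 (i + 1) j y hy, mul_assoc,
      pow_mul_wordVal_pushed hσ1 hσt (hl.labels i), hV, mul_assoc]
  have hv : ∀ i j, ∀ x ∈ Icc (0 : ℝ) 1, Q i j (x, 1) = Q i (j + 1) (x, 0) := fun i j x hx => by
    rw [hQ4 i j x hx, hQ1 i (j + 1) x hx, hT, mul_assoc, ← pow_succ]
  have hFc : Continuous (quadrantMap Q) := continuous_quadrantMap hQc hh hv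
  have hFs : ∀ z h, P.bary h (quadrantMap Q z) ≠ 0 →
      (V ⌊z.1⌋₊ * t ^ ⌊z.2⌋₊)⁻¹ * h ∈ K (l ⌊z.1⌋₊) ⌊z.2⌋₊ := fun z h hz => hQ5 _ _ _ h hz
  have hbot : ∀ x, quadrantMap Q (x, 0) = P.ray v l x := fun x => by
    have e := hQ1 ⌊x⌋₊ 0 _ (sub_mem_unit (mem_floor_interval x))
    rw [ray_eq_path]
    simpa [quadrantMap, pushed, V] using e
  have hleft : ∀ y, quadrantMap Q (0, y) = P.periodicRay T v y := fun y => by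
    have e := hQ3 0 ⌊y⌋₊ _ (sub_mem_unit (mem_floor_interval y))
    rw [periodicRay, hT]
    simpa [quadrantMap, V, rayVertex] using e
  -- At time `x` the homotopy follows the segment from `(x, 0)` to `(0, x)`, which shrinks to the
  -- corner for `x = 0`.
  refine ⟨fun p => quadrantMap Q (p.1 * unitInterval.toNNReal (unitInterval.symm p.2),
      p.1 * unitInterval.toNNReal p.2),
    hFc.comp (by fun_prop), fun x => by simp [hbot], fun x => by simp [hleft], fun y => ?_,
    fun p hp => ?_, fun h => ?_⟩
  · simp [hbot]
  · obtain ⟨h, hhE, hhp⟩ := hCE _ hp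
    exact hVB _ ⟨hVN _, h, hhE, _, _, hl.labels _, hFs _ h hhp⟩
  -- Only finitely many columns meet the star of `h`, because the proper ray visits each of the
  -- finitely many vertices of `B {h}` finitely often. The row is bounded by `hJ`, and `p.1` is the
  -- sum of the two quadrant coordinates.
  · have hfin : {i | V i ∈ B {h}}.Finite :=
      (hB {h} (finite_singleton h)).preimage' fun b _ => P.finite_setOf_rayVertex_eq hl.proper b
    obtain ⟨I, hI⟩ := hfin.bddAbove
    refine ⟨(I + 1) + ((((lev h).toAdd - N + R).toNat : ℕ) + 1), fun p hp => ?_⟩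
    have hk := hFs _ h hp
    have h1 := hI (show _ ∈ {i | V i ∈ B {h}} from ⟨hVN _, h, rfl, _, _, hl.labels _, hk⟩)
    have h2 := hJ _ h _ _ (hVN _) (hl.labels _) hk
    dsimp only at h1 h2
    have hp1 : p.1 = p.1 * unitInterval.toNNReal (unitInterval.symm p.2) + p.1 * unitInterval.toNNReal p.2 := by
      rw [← mul_add, unitInterval.toNNReal_symm_add_toNNReal, mul_one]
    rw [hp1]
    refine add_le_add ((Nat.lt_floor_add_one _).le.trans ?_) ((Nat.lt_floor_add_one _).le.trans ?_)
    · gcongr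
    · gcongr

end FinitePresentation

/-! ### Consequences of the HNN structure, and the theorem -/

theorem IsAscendingHNNExtension.conj_mem {G : Type*} [Group G] {A : Subgroup G} {t : G}
    (h : IsAscendingHNNExtension A t) : ∀ a ∈ A, t⁻¹ * a * t ∈ A := by
  obtain ⟨φ, hφ, e, he, het⟩ := h
  intro a ha
  have key := congrArg e (AscendingHNN.conj_eq φ hφ ⟨a, ha⟩)
  simp only [map_mul, map_inv, he, het] at key
  rw [key]
  exact SetLike.coe_mem _

/-- The homomorphism to the infinite cyclic group which counts the stable letter. -/
theorem IsAscendingHNNExtension.exists_level {G : Type*} [Group G] {A : Subgroup G} {t : G}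
    (h : IsAscendingHNNExtension A t) : ∃ lev : G →* Multiplicative ℤ, (∀ a ∈ A, lev a = 1) ∧
      lev t = Multiplicative.ofAdd 1 := by
  obtain ⟨φ, hφ, e, he, het⟩ := h
  let f : AscendingHNN φ hφ →* Multiplicative ℤ :=
    HNNExtension.lift 1 (Multiplicative.ofAdd 1) (by simp)
  refine ⟨f.comp e.symm.toMonoidHom, fun a ha => ?_, ?_⟩
  · have : e.symm a = HNNExtension.of ⟨a, ha⟩ := by rw [MulEquiv.symm_apply_eq, he]
    simp [this, f]
  · have : e.symm t = HNNExtension.t := by rw [MulEquiv.symm_apply_eq, het]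
    simp [this, f]

end AscHNN

end

theorem proposition2p2 {G : Type*} [Group G] (A : Subgroup G) (hA : Infinite A) (t : G)
    (hG : AscHNN.IsAscendingHNNExtension A t)
    {S : Type*} (P : AscHNN.FinitePresentation G S)
    (𝒜 : Set S) (h𝒜 : Subgroup.closure (P.val '' 𝒜) = A) (N : ℕ) :
    P.SemistableAtInfinity A 𝒜 (t ^ N) ∧
    ∀ τ : S, P.val τ = t → ∀ C : Set P.CayleyComplex, IsCompact C →
      ∃ D : Set P.CayleyComplex, IsCompact D ∧ ∀ (v : G) (l : ℕ → S × Bool),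
        P.IsProperRayIn A 𝒜 (t ^ N) D v l →
          AscHNN.ProperlyHomotopicRelAvoiding C (P.ray v l) (P.ray v (fun _ => (τ, true))) := by
  have hconj := hG.conj_mem
  obtain ⟨lev, hlev, hlevt⟩ := hG.exists_level
  refine ⟨fun C hC => ?_, fun τ hτ C hC => ?_⟩
  -- The stable letter need not be a generator: any word for it serves, and both rays are pushed to
  -- the same periodic ray.
  · obtain ⟨T, hT⟩ := P.exists_word t
    obtain ⟨D, hD, h⟩ := P.exists_compact_tameHomotopic h𝒜 hconj lev hlev hlevt (t ^ N) hT hC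
    exact ⟨D, hD, fun v l m hl hm => ((h v l hl).trans (h v m hm).symm).properlyHomotopic⟩
  · obtain ⟨D, hD, h⟩ := P.exists_compact_tameHomotopic h𝒜 hconj lev hlev hlevt (t ^ N)
      (T := [(τ, true)]) (by simp [AscHNN.FinitePresentation.letter, hτ]) hC
    refine ⟨D, hD, fun v l hl => ?_⟩
    rw [← P.periodicRay_singleton]
    exact (h v l hl).properlyHomotopic
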